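/- Fix an infinite set $\mathbb{A}$ of names with decidable equality. A 01-substitution set is a nominal set $X$ (a set with an action of the finite permutations of $\mathbb{A}$ in which every element has a finite support) with an equivariant operation $x\mapsto x(a:=i)$ ($a\in\mathbb{A}$, $i\in\{0,1\}$) such that $a\,\#\,x(a:=i)$; $x(a:=i)=x$ if $a\,\#\,x$; and $x(a:=i)(a':=i')=x(a':=i')(a:=i)$ if $a\neq a'$. Here $a\,\#\,x$ means that $x$ has a finite support not containing $a$. Morphisms are the equivariant maps that preserve substitution; the category is $\mathsf{01Sub}$. For $f:X\to Y$ in $\mathsf{01Sub}$, a finite $A\subseteq\mathbb{A}$, $a\in A$ and $d\in\{0,1\}$, a $d$-open $(A,a)$-box over $f$ is a pair $(u,y)$ with $y\in Y$ and $u:(A\times 2)\setminus\{(a,d)\}\to X$ such that $b\,\#\,u(b,i)$, $f(u(b,i))=y(b:=i)$, and $u(b,i)(b':=i')=u(b',i')(b:=i)$ whenever $b\neq b'$. Let $Kf$, with $\lambda_f:X\to Kf$ and $\rho_f:Kf\to Y$, be the 01-substitution set obtained from $X$ by freely and inductively adjoining, for $d=0,1$, every $d$-open $(A,a)$-box $(u,y)$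 over $\rho_f$ as an element of $Kf$, together with the element $\langle a\rangle(u,y)$ (a class up to $\alpha$-equivalence, in a separate copy for each $d$). Here $\rho_f(x)=f(x)$, $\rho_f(u,y)=y$, $\rho_f(\langle a\rangle(u,y))=y(a:=d)$. Substitution is that of $X$ on elements of $X$, and otherwise $$(u,y)(b:=i)=\begin{cases}u(b,i)&(b,i)\in(A\times2)\setminus\{(a,d)\}\\ \langle a\rangle(u,y)&(b,i)=(a,d)\\ (u(b:=i),y(b:=i))&b\notin A\end{cases}$$ $$\langle a\rangle(u,y)(b:=i)=\begin{cases}u(b,i)(a:=d)&b\in A\\ \langle a\rangle(u(b:=i),y(b:=i))&b\notin A\end{cases}\qquad(b\neq a).$$ A commutative square $(h,k)$ from $g:U\to V$ to $f:X\to Y$ (that is, $fh=kg$) induces $K(h,k):Kg\to Kf$ by $x\mapsto h(x)$, $(u,y)\mapsto(K(h,k)\circ u,k(y))$, $\langle a\rangle(u,y)\mapsto\langle a\rangle(K(h,k)\circ u,k(y))$. Now let $f:X\to Y$ be any morphism of $\mathsf{01Sub}$ (in particular, any Kan fibration), with diagonal $\Delta_f:X\to X\times_YX$. The pre-normal forms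 in direction $a\in\mathbb{A}$ are the elements of $K\Delta_f$ defined inductively as follows: every $x\in X$ with $a\,\#\,x$ is one; and if $(u,(x_1,x_2))$ is a $1$-open $(A,a)$-box over $\rho_{\Delta_f}$ with $a\,\#\,x_1$, $u(a,0)=x_1$ and $u(b,i)$ a pre-normal form in direction $a$ for all $(b,i)\in(A\setminus\{a\})\times 2$, then $(u,(x_1,x_2))$ is one. A normal form is an element $z(a:=1)$ with $z$ a pre-normal form in direction $a$, for some $a$. The labelled path object $P_YX$ is the sub-01-substitution set of $K\Delta_f$ that consists of the normal forms, and $p_f:P_YX\to Y$ is $\rho_{\Delta_f}$ followed by the canonical map $X\times_YX\to Y$. **Theorem.** For every commutative square $$\begin{array}{ccc}U&\xrightarrow{\;h\;}&X\\ {\scriptstyle g}\downarrow&&\downarrow{\scriptstyle f}\\ V&\xrightarrow{\;k\;}&Y\end{array}$$ in $\mathsf{01Sub}$, the map $K(h,h\times h):K\Delta_g\to K\Delta_f$ restricts to a morphism $P(h,k):P_VU\to P_YX$. The assignment $(h,k)\mapsto P(h,k)$ preserves identity squares and horizontal composites of squares, and $p_f\circ P(h,k)=k\circ p_g$. Furthermore,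 if the given square is a pullback, then so is the square $$\begin{array}{ccc}P_VU&\xrightarrow{P(h,k)}&P_YX\\ {\scriptstyle p_g}\downarrow&&\downarrow{\scriptstyle p_f}\\ V&\xrightarrow{\;\;k\;\;}&Y.\end{array}$$ -/

import Mathlib

open CategoryTheory
open scoped Pointwise

universe u

namespace ZeroOne

/-! ### Names, finite permutations, supports and freshness -/

section Nominal

variable {𝔸 : Type u}

/-- The group of finite permutations of the set of names: those which fix all but finitely many
names. -/
def FinPerm (𝔸 : Type u) : Subgroup (Equiv.Perm 𝔸) where
  carrier := {π | {a | π a ≠ a}.Finite}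
  one_mem' := by simp
  mul_mem' := by
    intro π σ hπ hσ
    refine (Set.Finite.union hπ hσ).subset ?_
    intro a ha
    by_contra hc
    simp only [Set.mem_union, Set.mem_ofPred_eq, not_or, not_not] at hc
    exact ha (by rw [Equiv.Perm.mul_apply, hc.2, hc.1])
  inv_mem' := by
    intro π hπ
    refine Set.Finite.subset hπ ?_
    intro a ha hc
    exact ha (by rw [Equiv.Perm.inv_eq_iff_eq]; exact hc.symm)

/-- The transposition of two names, as a finite permutation. -/
def swap [DecidableEq 𝔸] (a b : 𝔸) : FinPerm 𝔸 :=
  ⟨Equiv.swap a b, by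
    refine Set.Finite.subset (Set.toFinite {a, b}) ?_
    intro c hc
    by_contra h
    simp only [Set.mem_insert_iff, Set.mem_singleton_iff, not_or] at h
    exact hc (Equiv.swap_apply_of_ne_of_ne h.1 h.2)⟩

/-- A name `a` is fresh for `x` if `x` has a finite support which does not contain `a`. -/
def Fresh {X : Type u} [MulAction (FinPerm 𝔸) X] (a : 𝔸) (x : X) : Prop :=
  ∃ S : Finset 𝔸, a ∉ S ∧ MulAction.Supports (FinPerm 𝔸) (S : Set 𝔸) x

theorem perm_smul_def (π : FinPerm 𝔸) (a : 𝔸) : π • a = (π : Equiv.Perm 𝔸) a := rfl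

section
variable [DecidableEq 𝔸]

@[simp] theorem swap_smul_left (a b : 𝔸) : swap a b • a = b := Equiv.swap_apply_left a b
@[simp] theorem swap_smul_right (a b : 𝔸) : swap a b • b = a := Equiv.swap_apply_right a b
theorem swap_smul_ne {a b c : 𝔸} (h : c ≠ a) (h' : c ≠ b) : swap a b • c = c :=
  Equiv.swap_apply_of_ne_of_ne h h'
@[simp] theorem swap_inv (a b : 𝔸) : (swap a b)⁻¹ = swap a b :=
  Subtype.ext (Equiv.swap_inv a b)
@[simp] theorem swap_swap_smul {X : Type u} [MulAction (FinPerm 𝔸) X] (a b : 𝔸) (x : X) :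
    swap a b • swap a b • x = x := by
  have := inv_smul_smul (swap a b) x
  rwa [swap_inv] at this

theorem finset_smul_eq {π : FinPerm 𝔸} {A : Finset 𝔸} (h : ∀ s ∈ A, π • s = s) : π • A = A := by
  rw [Finset.smul_finset_def]
  conv_rhs => rw [← Finset.image_id (s := A)]
  exact Finset.image_congr (fun s hs => h s hs)

end

variable {X : Type u} [MulAction (FinPerm 𝔸) X]

theorem Fresh.smul [DecidableEq 𝔸] {a : 𝔸} {x : X} (h : Fresh a x) (π : FinPerm 𝔸) :
    Fresh (π • a) (π • x) := by
  obtain ⟨S, hS, hx⟩ := h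
  refine ⟨π • S, by rwa [Finset.smul_mem_smul_finset_iff], ?_⟩
  intro σ hσ
  have : (π⁻¹ * σ * π) • x = x := by
    apply hx
    intro s hs
    have := hσ (a := π • s) (by
      have : π • s ∈ π • S := (Finset.smul_mem_smul_finset_iff _).2 hs
      exact_mod_cast this)
    rw [mul_smul, mul_smul, this, inv_smul_smul]
  rw [mul_smul, mul_smul, inv_smul_eq_iff] at this
  exact this

end Nominal

/-! ### The category of 01-substitution sets -/

/-- A 01-substitution set over the set of names `𝔸`: a nominal set with an equivariant
substitution operation `x (a := i)`, where `i` is `0` (`false`) or `1` (`true`). -/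
structure SubSet (𝔸 : Type u) [DecidableEq 𝔸] where
  carrier : Type u
  [act : MulAction (FinPerm 𝔸) carrier]
  /-- `sub x a i` is `x (a := i)` -/
  sub : carrier → 𝔸 → Bool → carrier
  finite_support : ∀ x : carrier, ∃ S : Finset 𝔸, MulAction.Supports (FinPerm 𝔸) (S : Set 𝔸) x
  smul_sub : ∀ (π : FinPerm 𝔸) (x : carrier) (a : 𝔸) (i : Bool),
    π • sub x a i = sub (π • x) (π • a) i
  fresh_sub : ∀ (x : carrier) (a : 𝔸) (i : Bool), Fresh a (sub x a i)
  sub_of_fresh : ∀ (x : carrier) (a : 𝔸) (i : Bool), Fresh a x → sub x a i = x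
  sub_comm : ∀ (x : carrier) (a a' : 𝔸) (i i' : Bool), a ≠ a' →
    sub (sub x a i) a' i' = sub (sub x a' i') a i

attribute [instance] SubSet.act

instance {𝔸 : Type u} [DecidableEq 𝔸] : CoeSort (SubSet 𝔸) (Type u) := ⟨SubSet.carrier⟩

/-- Morphisms of 01-substitution sets: equivariant maps that preserve substitution. -/
@[ext] structure SubSet.Hom {𝔸 : Type u} [DecidableEq 𝔸] (X Y : SubSet 𝔸) where
  toFun : X → Y
  map_smul : ∀ (π : FinPerm 𝔸) (x : X), toFun (π • x) = π • toFun x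
  map_sub : ∀ (x : X) (a : 𝔸) (i : Bool), toFun (X.sub x a i) = Y.sub (toFun x) a i

instance {𝔸 : Type u} [DecidableEq 𝔸] : Category (SubSet 𝔸) where
  Hom X Y := SubSet.Hom X Y
  id X := ⟨fun x => x, fun _ _ => rfl, fun _ _ _ => rfl⟩
  comp f g := ⟨fun x => g.toFun (f.toFun x),
    fun π x => by rw [f.map_smul, g.map_smul], fun x a i => by rw [f.map_sub, g.map_sub]⟩

section Basics

set_option linter.unusedSectionVars false

variable {𝔸 : Type u} [DecidableEq 𝔸]

instance (X Y : SubSet 𝔸) : CoeFun (X ⟶ Y) (fun _ => X → Y) := ⟨SubSet.Hom.toFun⟩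

theorem SubSet.hom_ext {X Y : SubSet 𝔸} {f g : X ⟶ Y} (h : ∀ x : X, f x = g x) : f = g :=
  SubSet.Hom.ext (funext h)

@[simp] theorem SubSet.id_apply (X : SubSet 𝔸) (x : X) : (𝟙 X : X ⟶ X) x = x := rfl
@[simp] theorem SubSet.comp_apply {X Y Z : SubSet 𝔸} (f : X ⟶ Y) (g : Y ⟶ Z) (x : X) :
    (f ≫ g) x = g (f x) := rfl

theorem SubSet.congr_hom {X Y : SubSet 𝔸} {f g : X ⟶ Y} (h : f = g) (x : X) : f x = g x := by
  rw [h]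

theorem SubSet.hom_smul {X Y : SubSet 𝔸} (f : X ⟶ Y) (π : FinPerm 𝔸) (x : X) :
    f (π • x) = π • f x := SubSet.Hom.map_smul f π x
theorem SubSet.hom_sub {X Y : SubSet 𝔸} (f : X ⟶ Y) (x : X) (a : 𝔸) (i : Bool) :
    f (X.sub x a i) = Y.sub (f x) a i := SubSet.Hom.map_sub f x a i

theorem SubSet.Fresh.map {X Y : SubSet 𝔸} (f : X ⟶ Y) {a : 𝔸} {x : X} (h : Fresh a x) :
    Fresh a (f x) := by
  obtain ⟨S, hS, hx⟩ := h
  exact ⟨S, hS, fun π hπ => by rw [← SubSet.hom_smul, hx π hπ]⟩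

theorem SubSet.sub_sub_self (X : SubSet 𝔸) (x : X) (a : 𝔸) (i j : Bool) :
    X.sub (X.sub x a i) a j = X.sub x a i :=
  X.sub_of_fresh _ _ _ (X.fresh_sub _ _ _)

theorem SubSet.Fresh.sub {X : SubSet 𝔸} {c : 𝔸} {x : X} (h : Fresh c x) (a : 𝔸) (i : Bool) :
    Fresh c (X.sub x a i) := by
  by_cases hca : c = a
  · subst hca; exact X.fresh_sub _ _ _
  · rw [← X.sub_of_fresh x c false h, X.sub_comm _ _ _ _ _ hca]
    exact X.fresh_sub _ _ _

/-! ### Open boxes -/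

/-- `InBox A a d b i` says that `(b, i)` is an element of `(A × 2) \ {(a, d)}`. -/
def InBox (A : Finset 𝔸) (a : 𝔸) (d : Bool) (b : 𝔸) (i : Bool) : Prop :=
  b ∈ A ∧ ¬ (b = a ∧ i = d)

instance (A : Finset 𝔸) (a : 𝔸) (d : Bool) (b : 𝔸) (i : Bool) : Decidable (InBox A a d b i) := by
  unfold InBox; infer_instance

/-- The `d`-open `(A, a)`-boxes `(u, y)` over `f`; `d = true` gives the `1`-open boxes and
`d = false` the `0`-open ones. -/
@[ext] structure OpenBox {X Y : SubSet 𝔸} (f : X ⟶ Y) (d : Bool) (A : Finset 𝔸) (a : 𝔸) where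
  mem : a ∈ A
  u : ∀ (b : 𝔸) (i : Bool), InBox A a d b i → X
  y : Y
  fresh : ∀ b i (h : InBox A a d b i), Fresh b (u b i h)
  adj : ∀ b i (h : InBox A a d b i) b' i' (h' : InBox A a d b' i'), b ≠ b' →
    X.sub (u b i h) b' i' = X.sub (u b' i' h') b i
  lies : ∀ b i (h : InBox A a d b i), f (u b i h) = Y.sub y b i

theorem InBox.smul_iff (π : FinPerm 𝔸) {A : Finset 𝔸} {a : 𝔸} {d : Bool} {b : 𝔸} {i : Bool} :
    InBox (π • A) (π • a) d b i ↔ InBox A a d (π⁻¹ • b) i := by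
  unfold InBox
  rw [Finset.inv_smul_mem_iff, inv_smul_eq_iff]

theorem inBox_base {A : Finset 𝔸} {a : 𝔸} (h : a ∈ A) (d : Bool) : InBox A a d a (!d) :=
  ⟨h, fun hh => by cases d <;> simp at hh⟩

/-- The image of an open box under a finite permutation. -/
def OpenBox.smul {X Y : SubSet 𝔸} {f : X ⟶ Y} {d : Bool} {A : Finset 𝔸} {a : 𝔸}
    (π : FinPerm 𝔸) (B : OpenBox f d A a) : OpenBox f d (π • A) (π • a) where
  mem := (Finset.smul_mem_smul_finset_iff π).2 B.mem
  u b i h := π • B.u (π⁻¹ • b) i ((InBox.smul_iff π).1 h)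
  y := π • B.y
  fresh b i h := by
    have := (B.fresh _ i ((InBox.smul_iff π).1 h)).smul π
    rwa [smul_inv_smul] at this
  adj b i h b' i' h' hne := by
    have := congrArg (fun z => π • z) (B.adj _ i ((InBox.smul_iff π).1 h) _ i'
      ((InBox.smul_iff π).1 h') (by simpa using hne))
    simp only [X.smul_sub, smul_inv_smul] at this
    exact this
  lies b i h := by
    rw [SubSet.hom_smul, B.lies, Y.smul_sub, smul_inv_smul]

/-- The open box `(u, y)(c := j)`, for `c` not in `A`. -/
def OpenBox.sub {X Y : SubSet 𝔸} {f : X ⟶ Y} {d : Bool} {A : Finset 𝔸} {a : 𝔸}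
    (B : OpenBox f d A a) (c : 𝔸) (j : Bool) (hc : c ∉ A) : OpenBox f d A a where
  mem := B.mem
  u b i h := X.sub (B.u b i h) c j
  y := Y.sub B.y c j
  fresh b i h := SubSet.Fresh.sub (B.fresh b i h) c j
  adj b i h b' i' h' hne := by
    have h1 : c ≠ b := fun e => hc (e ▸ h.1)
    have h2 : c ≠ b' := fun e => hc (e ▸ h'.1)
    rw [X.sub_comm _ _ _ _ _ h2, B.adj b i h b' i' h' hne, X.sub_comm _ _ _ _ _ h1]
  lies b i h := by
    have h1 : c ≠ b := fun e => hc (e ▸ h.1)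
    rw [SubSet.hom_sub, B.lies, Y.sub_comm _ _ _ _ _ h1]

end Basics

/-! ### The factorisation object `K f`

The elements of `K f` are generated inductively: an element is an element of `X`, a `d`-open
`(A, a)`-box `(u, y)` of previously generated elements over `y`, or the class `⟨a⟩(u, y)` of such
a box in the name abstraction. `Raw` is the type of trees that represent them, `WF` singles out
the trees whose boxes are open boxes, and `Eqv` is equality of the represented elements: it ignores
the values of `u` outside `(A × 2) \ {(a, d)}`, and in the last case it is `α`-equivalence. -/

/-- Trees representing elements of `K f`. -/
inductive Raw (𝔸 X Y : Type u) : Type u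
  | pt (x : X) : Raw 𝔸 X Y
  | fill (d : Bool) (A : Finset 𝔸) (a : 𝔸) (u : 𝔸 → Bool → Raw 𝔸 X Y) (y : Y) : Raw 𝔸 X Y
  | comp (d : Bool) (A : Finset 𝔸) (a : 𝔸) (u : 𝔸 → Bool → Raw 𝔸 X Y) (y : Y) : Raw 𝔸 X Y

namespace Raw

section Action

set_option linter.unusedSectionVars false

variable {𝔸 X Y : Type u} [DecidableEq 𝔸] [MulAction (FinPerm 𝔸) X] [MulAction (FinPerm 𝔸) Y]

/-- The action of finite permutations on trees. -/
def perm (π : FinPerm 𝔸) : Raw 𝔸 X Y → Raw 𝔸 X Y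
  | pt x => pt (π • x)
  | fill d A a u y => fill d (π • A) (π • a) (fun b i => perm π (u (π⁻¹ • b) i)) (π • y)
  | comp d A a u y => comp d (π • A) (π • a) (fun b i => perm π (u (π⁻¹ • b) i)) (π • y)

theorem perm_one (t : Raw 𝔸 X Y) : perm 1 t = t := by
  induction t with
  | pt x => simp [perm]
  | fill d A a u y ih => simp [perm, ih]
  | comp d A a u y ih => simp [perm, ih]

theorem perm_mul (π σ : FinPerm 𝔸) (t : Raw 𝔸 X Y) : perm (π * σ) t = perm π (perm σ t) := by
  induction t with
  | pt x => simp [perm, mul_smul]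
  | fill d A a u y ih => simp [perm, ih, mul_smul]
  | comp d A a u y ih => simp [perm, ih, mul_smul]

instance : MulAction (FinPerm 𝔸) (Raw 𝔸 X Y) where
  smul := perm
  one_smul := perm_one
  mul_smul := perm_mul

variable (π : FinPerm 𝔸)

theorem smul_pt (x : X) : π • (pt x : Raw 𝔸 X Y) = pt (π • x) := rfl
theorem smul_fill (d : Bool) (A : Finset 𝔸) (a : 𝔸) (u : 𝔸 → Bool → Raw 𝔸 X Y) (y : Y) :
    π • fill d A a u y = fill d (π • A) (π • a) (fun b i => π • u (π⁻¹ • b) i) (π • y) := rfl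
theorem smul_comp (d : Bool) (A : Finset 𝔸) (a : 𝔸) (u : 𝔸 → Bool → Raw 𝔸 X Y) (y : Y) :
    π • comp d A a u y = comp d (π • A) (π • a) (fun b i => π • u (π⁻¹ • b) i) (π • y) := rfl

/-- Equality of the represented elements. For `⟨a⟩(u, y) = ⟨a'⟩(u', y')` it requires that
`(c a) (u, y) = (c a') (u', y')` for all but finitely many names `c`. -/
inductive Eqv : Raw 𝔸 X Y → Raw 𝔸 X Y → Prop
  | pt (x : X) : Eqv (pt x) (pt x)
  | fill {d : Bool} {A : Finset 𝔸} {a : 𝔸} {u u' : 𝔸 → Bool → Raw 𝔸 X Y} {y : Y}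
      (h : ∀ b i, InBox A a d b i → Eqv (u b i) (u' b i)) :
      Eqv (fill d A a u y) (fill d A a u' y)
  | comp {d : Bool} {A A' : Finset 𝔸} {a a' : 𝔸} {u u' : 𝔸 → Bool → Raw 𝔸 X Y} {y y' : Y}
      (S : Finset 𝔸)
      (hA : ∀ c, c ∉ S → swap c a • A = swap c a' • A')
      (hy : ∀ c, c ∉ S → swap c a • y = swap c a' • y')
      (hu : ∀ c, c ∉ S → ∀ b i, InBox (swap c a • A) c d b i →
        Eqv (swap c a • u ((swap c a)⁻¹ • b) i) (swap c a' • u' ((swap c a')⁻¹ • b) i)) :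
      Eqv (comp d A a u y) (comp d A' a' u' y')

theorem eqv_fill_iff {d d' : Bool} {A A' : Finset 𝔸} {a a' : 𝔸}
    {u u' : 𝔸 → Bool → Raw 𝔸 X Y} {y y' : Y} :
    Eqv (fill d A a u y) (fill d' A' a' u' y') ↔
      d = d' ∧ A = A' ∧ a = a' ∧ y = y' ∧ ∀ b i, InBox A a d b i → Eqv (u b i) (u' b i) := by
  constructor
  · rintro ⟨⟩
    exact ⟨rfl, rfl, rfl, rfl, by assumption⟩
  · rintro ⟨rfl, rfl, rfl, rfl, h⟩
    exact Eqv.fill h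

theorem eqv_comp_iff {d d' : Bool} {A A' : Finset 𝔸} {a a' : 𝔸}
    {u u' : 𝔸 → Bool → Raw 𝔸 X Y} {y y' : Y} :
    Eqv (comp d A a u y) (comp d' A' a' u' y') ↔
      d = d' ∧ ∃ S : Finset 𝔸, ∀ c, c ∉ S →
        Eqv (swap c a • fill d A a u y) (swap c a' • fill d' A' a' u' y') := by
  constructor
  · intro h
    cases h with
    | comp S hA hy hu =>
    refine ⟨rfl, S, fun c hc => ?_⟩
    rw [smul_fill, smul_fill, eqv_fill_iff]
    refine ⟨rfl, hA c hc, by simp, hy c hc, ?_⟩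
    rw [swap_smul_right]
    exact hu c hc
  · rintro ⟨rfl, S, h⟩
    simp only [smul_fill, eqv_fill_iff] at h
    refine Eqv.comp S (fun c hc => (h c hc).2.1) (fun c hc => (h c hc).2.2.2.1) ?_
    intro c hc
    have := (h c hc).2.2.2.2
    rwa [swap_smul_right] at this

theorem Eqv.refl (t : Raw 𝔸 X Y) : Eqv t t := by
  have key : ∀ (t : Raw 𝔸 X Y) (π : FinPerm 𝔸), Eqv (π • t) (π • t) := by
    intro t
    induction t with
    | pt x => exact fun π => Eqv.pt _
    | fill d A a u y ih => exact fun π => Eqv.fill (fun b i _ => ih _ _ π)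
    | comp d A a u y ih =>
      intro π
      refine Eqv.comp ∅ (fun _ _ => rfl) (fun _ _ => rfl) (fun c _ b i _ => ?_)
      have := ih (π⁻¹ • (swap c (π • a))⁻¹ • b) i (swap c (π • a) * π)
      rwa [mul_smul] at this
  simpa using key t 1

theorem Eqv.symm {t s : Raw 𝔸 X Y} (h : Eqv t s) : Eqv s t := by
  induction h with
  | pt x => exact Eqv.pt x
  | fill h ih => exact Eqv.fill ih
  | comp S hA hy hu ih =>
    refine Eqv.comp S (fun c hc => (hA c hc).symm) (fun c hc => (hy c hc).symm) ?_
    intro c hc b i hb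
    rw [← hA c hc] at hb
    exact ih c hc b i hb

theorem Eqv.trans {t s r : Raw 𝔸 X Y} (h : Eqv t s) (h' : Eqv s r) : Eqv t r := by
  induction h generalizing r with
  | pt x => exact h'
  | fill h ih =>
    cases h' with
    | fill h' => exact Eqv.fill (fun b i hb => ih b i hb (h' b i hb))
  | comp S hA hy hu ih =>
    cases h' with
    | comp S' hA' hy' hu' =>
      refine Eqv.comp (S ∪ S') ?_ ?_ ?_
      · intro c hc
        simp only [Finset.mem_union, not_or] at hc
        exact (hA c hc.1).trans (hA' c hc.2)
      · intro c hc
        simp only [Finset.mem_union, not_or] at hc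
        exact (hy c hc.1).trans (hy' c hc.2)
      · intro c hc b i hb
        simp only [Finset.mem_union, not_or] at hc
        exact ih c hc.1 b i hb (hu' c hc.2 b i (by rwa [← hA c hc.1]))

theorem conj_swap (π : FinPerm 𝔸) (c a : 𝔸) {Z : Type u} [MulAction (FinPerm 𝔸) Z] (z : Z) :
    swap c (π • a) • π • z = π • swap (π⁻¹ • c) a • z := by
  have : swap c (π • a) * π = π * swap (π⁻¹ • c) a := by
    have e := Equiv.mul_swap_eq_swap_mul (π : Equiv.Perm 𝔸) (π⁻¹ • c) a
    apply Subtype.ext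
    have e2 : (π : Equiv.Perm 𝔸) (π⁻¹ • c) = c := smul_inv_smul π c
    rw [e2] at e
    exact e.symm
  rw [← mul_smul, this, mul_smul]

theorem Eqv.smul {t s : Raw 𝔸 X Y} (h : Eqv t s) (π : FinPerm 𝔸) : Eqv (π • t) (π • s) := by
  induction h with
  | pt x => exact Eqv.pt _
  | fill h ih => exact Eqv.fill (fun b i hb => ih _ i ((InBox.smul_iff π).1 hb))
  | @comp d A A' a a' u u' y y' S hA hy hu ih =>
    refine Eqv.comp (π • S) ?_ ?_ ?_
    · intro c hc
      rw [← Finset.inv_smul_mem_iff] at hc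
      rw [conj_swap, conj_swap, hA _ hc]
    · intro c hc
      rw [← Finset.inv_smul_mem_iff] at hc
      rw [conj_swap, conj_swap, hy _ hc]
    · intro c hc b i hb
      rw [← Finset.inv_smul_mem_iff] at hc
      rw [conj_swap] at hb
      have hb' : InBox (π • swap (π⁻¹ • c) a • A) (π • (π⁻¹ • c)) d b i := by
        rw [smul_inv_smul]; exact hb
      have := ih _ hc _ i ((InBox.smul_iff π).1 hb')
      change Eqv (swap c (π • a) • π • _) (swap c (π • a') • π • _)
      rw [conj_swap, conj_swap]
      have e : ∀ a'' : 𝔸, π⁻¹ • (swap c (π • a''))⁻¹ • b = (swap (π⁻¹ • c) a'')⁻¹ • π⁻¹ • b := by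
        intro a''
        rw [← mul_smul, ← mul_smul, ← mul_inv_rev, ← mul_inv_rev]
        congr 2
        have e := Equiv.mul_swap_eq_swap_mul (π : Equiv.Perm 𝔸) (π⁻¹ • c) a''
        apply Subtype.ext
        have e2 : (π : Equiv.Perm 𝔸) (π⁻¹ • c) = c := smul_inv_smul π c
        rw [e2] at e
        exact e.symm
      rw [e, e]
      exact this

theorem Eqv.smul_iff {t s : Raw 𝔸 X Y} (π : FinPerm 𝔸) : Eqv (π • t) (π • s) ↔ Eqv t s :=
  ⟨fun h => by simpa using h.smul π⁻¹, fun h => h.smul π⟩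

theorem Eqv.comp_of_fill {d : Bool} {A A' : Finset 𝔸} {a a' : 𝔸} {u u' : 𝔸 → Bool → Raw 𝔸 X Y}
    {y y' : Y} (h : Eqv (Raw.fill d A a u y) (Raw.fill d A' a' u' y')) :
    Eqv (Raw.comp d A a u y) (Raw.comp d A' a' u' y') := by
  obtain ⟨-, -, rfl, -, -⟩ := eqv_fill_iff.1 h
  exact eqv_comp_iff.2 ⟨rfl, ∅, fun c _ => h.smul _⟩

/-- Freshness of a name for the represented element. -/
def RFresh (b : 𝔸) (t : Raw 𝔸 X Y) : Prop :=
  ∃ S : Finset 𝔸, b ∉ S ∧ ∀ π : FinPerm 𝔸, (∀ s ∈ S, π • s = s) → Eqv (π • t) t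

theorem RFresh.smul {b : 𝔸} {t : Raw 𝔸 X Y} (h : RFresh b t) (π : FinPerm 𝔸) :
    RFresh (π • b) (π • t) := by
  obtain ⟨S, hS, hx⟩ := h
  refine ⟨π • S, by rwa [Finset.smul_mem_smul_finset_iff], ?_⟩
  intro σ hσ
  have : Eqv ((π⁻¹ * σ * π) • t) t := by
    apply hx
    intro s hs
    rw [mul_smul, mul_smul, hσ (π • s) ((Finset.smul_mem_smul_finset_iff _).2 hs), inv_smul_smul]
  have := this.smul π
  rwa [mul_smul, mul_smul, smul_inv_smul] at this

theorem RFresh.eqv {b : 𝔸} {t s : Raw 𝔸 X Y} (h : RFresh b t) (e : Eqv t s) : RFresh b s := by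
  obtain ⟨S, hS, hx⟩ := h
  exact ⟨S, hS, fun π hπ => ((e.smul π).symm.trans (hx π hπ)).trans e⟩

theorem exists_not_mem [Infinite 𝔸] (S : Finset 𝔸) : ∃ c : 𝔸, c ∉ S :=
  Infinite.exists_notMem_finset S

theorem swap_fix {S : Finset 𝔸} {a b : 𝔸} (ha : a ∉ S) (hb : b ∉ S) :
    ∀ s ∈ S, swap a b • s = s := fun _ hs =>
  swap_smul_ne (fun h => ha (h ▸ hs)) (fun h => hb (h ▸ hs))

theorem RFresh.swap_eqv [Infinite 𝔸] {b c : 𝔸} {t : Raw 𝔸 X Y} (hb : RFresh b t)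
    (hc : RFresh c t) : Eqv (swap b c • t) t := by
  obtain ⟨S, hS, hx⟩ := hb
  obtain ⟨S', hS', hx'⟩ := hc
  obtain ⟨e, he⟩ := exists_not_mem (S ∪ S' ∪ {b, c})
  simp only [Finset.mem_union, Finset.mem_insert, Finset.mem_singleton, not_or] at he
  obtain ⟨⟨h1, h2⟩, h3, h4⟩ := he
  by_cases hbc : b = c
  · subst hbc; exact hx _ (swap_fix hS hS)
  have key : swap b c = swap b e * swap e c * swap b e := by
    apply Subtype.ext
    change Equiv.swap b c = Equiv.swap b e * Equiv.swap e c * Equiv.swap b e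
    have h5 := Equiv.swap_mul_swap_mul_swap (x := c) (y := e) (z := b) (Ne.symm h4) (Ne.symm hbc)
    rw [Equiv.swap_comm e b, Equiv.swap_comm c e] at h5
    exact h5.symm
  rw [key, mul_smul, mul_smul]
  have e1 := hx (swap b e) (swap_fix hS h1)
  have e2 := hx' (swap e c) (swap_fix h2 hS')
  exact (((e1.smul _).trans e2).smul _).trans e1

/-! Freshness for the three kinds of trees. -/

theorem rfresh_pt {b : 𝔸} {x : X} (h : Fresh b x) : RFresh b (pt x : Raw 𝔸 X Y) := by
  obtain ⟨S, hS, hx⟩ := h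
  refine ⟨S, hS, fun π hπ => ?_⟩
  rw [smul_pt, hx π (fun a ha => hπ a (by exact_mod_cast ha))]
  exact Eqv.refl _

theorem rfresh_pt_iff {b : 𝔸} {x : X} : RFresh b (pt x : Raw 𝔸 X Y) ↔ Fresh b x := by
  refine ⟨?_, rfresh_pt⟩
  rintro ⟨S, hS, hx⟩
  refine ⟨S, hS, fun π hπ => ?_⟩
  have := hx π (fun a ha => hπ (by exact_mod_cast ha))
  rw [smul_pt] at this
  generalize π • x = z at this ⊢
  cases this
  rfl

theorem rfresh_fill {c : 𝔸} {d : Bool} {A : Finset 𝔸} {a : 𝔸} {u : 𝔸 → Bool → Raw 𝔸 X Y} {y : Y}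
    (ha : a ∈ A) (hA : c ∉ A) (hy : Fresh c y) (hu : ∀ b i, InBox A a d b i → RFresh c (u b i)) :
    RFresh c (fill d A a u y) := by
  classical
  obtain ⟨S, hS, hSy⟩ := hy
  choose! T hT hTu using hu
  refine ⟨A ∪ S ∪ (A ×ˢ Finset.univ).biUnion
    (fun p => if InBox A a d p.1 p.2 then T p.1 p.2 else ∅), ?_, ?_⟩
  · simp only [Finset.mem_union, Finset.mem_biUnion, not_or, not_exists]
    refine ⟨⟨hA, hS⟩, ?_⟩
    rintro ⟨b, i⟩ ⟨-, h2⟩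
    dsimp only at h2
    split_ifs at h2 with h3
    · exact hT b i h3 h2
    · simp at h2
  · intro π hπ
    have fA : ∀ s ∈ A, π • s = s := fun s hs => hπ s (by simp [hs])
    have fS : ∀ s ∈ S, π • s = s := fun s hs => hπ s (by simp [hs])
    have fT : ∀ b i, InBox A a d b i → ∀ s ∈ T b i, π • s = s := by
      intro b i hb s hs
      apply hπ
      simp only [Finset.mem_union, Finset.mem_biUnion]
      refine Or.inr ⟨(b, i), by simp [hb.1], ?_⟩
      simpa [hb] using hs
    rw [smul_fill, eqv_fill_iff]
    refine ⟨rfl, finset_smul_eq fA, fA a ha, hSy π (fun s hs => fS s (by exact_mod_cast hs)), ?_⟩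
    intro b i hb
    rw [finset_smul_eq fA, fA a ha] at hb
    have : π⁻¹ • b = b := by rw [inv_smul_eq_iff, fA b hb.1]
    rw [this]
    exact hTu b i hb π (fT b i hb)

theorem rfresh_fill_inv [Infinite 𝔸] {c : 𝔸} {d : Bool} {A : Finset 𝔸} {a : 𝔸}
    {u : 𝔸 → Bool → Raw 𝔸 X Y} {y : Y}
    (h : RFresh c (fill d A a u y)) :
    c ∉ A ∧ Fresh c y ∧ ∀ b i, InBox A a d b i → RFresh c (u b i) := by
  obtain ⟨S, hS, hx⟩ := h
  simp only [smul_fill, eqv_fill_iff] at hx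
  have hcA : c ∉ A := by
    intro hc
    obtain ⟨e, he⟩ := exists_not_mem (S ∪ A)
    simp only [Finset.mem_union, not_or] at he
    have := (hx (swap c e) (swap_fix hS he.1)).2.1
    rw [← this, ← Finset.inv_smul_mem_iff, swap_inv, swap_smul_right] at he
    exact he.2 hc
  refine ⟨hcA, ⟨S, hS, fun π hπ => (hx π (fun s hs => hπ (by exact_mod_cast hs))).2.2.2.1⟩, ?_⟩
  intro b i hb
  refine ⟨S ∪ A, by simp [hS, hcA], fun π hπ => ?_⟩
  obtain ⟨-, h1, h2, -, h3⟩ := hx π (fun s hs => hπ s (by simp [hs]))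
  have := h3 b i (by rwa [h1, h2])
  have hb' : π⁻¹ • b = b := by rw [inv_smul_eq_iff, hπ b (by simp [hb.1])]
  rwa [hb'] at this

theorem rsupp (hX : ∀ x : X, ∃ S : Finset 𝔸, MulAction.Supports (FinPerm 𝔸) (S : Set 𝔸) x)
    (hY : ∀ y : Y, ∃ S : Finset 𝔸, MulAction.Supports (FinPerm 𝔸) (S : Set 𝔸) y)
    (t : Raw 𝔸 X Y) :
    ∃ S : Finset 𝔸, ∀ π : FinPerm 𝔸, (∀ s ∈ S, π • s = s) → Eqv (π • t) t := by
  classical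
  have node : ∀ (d : Bool) (A : Finset 𝔸) (a : 𝔸) (u : 𝔸 → Bool → Raw 𝔸 X Y) (y : Y)
      (_ : ∀ b i, ∃ S : Finset 𝔸, ∀ π : FinPerm 𝔸, (∀ s ∈ S, π • s = s) →
        Eqv (π • u b i) (u b i)),
      ∃ S : Finset 𝔸, ∀ π : FinPerm 𝔸, (∀ s ∈ S, π • s = s) →
        Eqv (π • fill d A a u y) (fill d A a u y) := by
    intro d A a u y ih
    choose T hT using ih
    obtain ⟨S, hS⟩ := hY y
    refine ⟨insert a A ∪ S ∪ (A ×ˢ Finset.univ).biUnion (fun p => T p.1 p.2), fun π hπ => ?_⟩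
    have fA : ∀ s ∈ A, π • s = s := fun s hs => hπ s (by simp [hs])
    have fa : π • a = a := hπ a (by simp)
    rw [smul_fill, eqv_fill_iff]
    refine ⟨rfl, finset_smul_eq fA, fa,
      hS π (fun s hs => hπ s (by
        have : s ∈ S := by exact_mod_cast hs
        simp [this])), ?_⟩
    intro b i hb
    rw [finset_smul_eq fA, fa] at hb
    have : π⁻¹ • b = b := by rw [inv_smul_eq_iff, fA b hb.1]
    rw [this]
    apply hT b i
    intro s hs
    apply hπ
    simp only [Finset.mem_union, Finset.mem_biUnion]
    exact Or.inr ⟨(b, i), by simp [hb.1], hs⟩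
  induction t with
  | pt x =>
    obtain ⟨S, hS⟩ := hX x
    refine ⟨S, fun π hπ => ?_⟩
    rw [smul_pt, hS π (fun a ha => hπ a (by exact_mod_cast ha))]
    exact Eqv.refl _
  | fill d A a u y ih => exact node d A a u y ih
  | comp d A a u y ih =>
    obtain ⟨S, hS⟩ := node d A a u y ih
    exact ⟨S, fun π hπ => (hS π hπ).comp_of_fill⟩

theorem rfresh_comp {c : 𝔸} {d : Bool} {A : Finset 𝔸} {a : 𝔸} {u : 𝔸 → Bool → Raw 𝔸 X Y} {y : Y}
    (h : RFresh c (fill d A a u y)) : RFresh c (comp d A a u y) := by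
  obtain ⟨S, hS, hx⟩ := h
  exact ⟨S, hS, fun π hπ => (hx π hπ).comp_of_fill⟩

theorem rfresh_comp_self {d : Bool} {A : Finset 𝔸} {a : 𝔸} {u : 𝔸 → Bool → Raw 𝔸 X Y} {y : Y}
    (h : ∃ S : Finset 𝔸, ∀ π : FinPerm 𝔸, (∀ s ∈ S, π • s = s) →
      Eqv (π • fill d A a u y) (fill d A a u y)) : RFresh a (comp d A a u y) := by
  obtain ⟨S, hx⟩ := h
  refine ⟨S.erase a, by simp, fun π hπ => ?_⟩
  change Eqv (comp d (π • A) (π • a) (fun b i => π • u (π⁻¹ • b) i) (π • y)) _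
  refine eqv_comp_iff.2 ⟨rfl, S, fun e he => ?_⟩
  change Eqv (swap e (π • a) • π • fill d A a u y) _
  rw [← Eqv.smul_iff (swap e a)⁻¹, inv_smul_smul, ← mul_smul, ← mul_smul]
  apply hx
  intro s hs
  rw [mul_smul, mul_smul]
  by_cases hsa : s = a
  · subst hsa
    rw [swap_smul_right, inv_smul_eq_iff, swap_smul_right]
  · have h1 : π • s = s := hπ s (by simp [hsa, hs])
    have h2 : s ≠ e := fun h => he (h ▸ hs)
    have h3 : s ≠ π • a := by
      intro h
      rw [← h1] at h
      exact hsa (MulAction.injective π h)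
    rw [h1, swap_smul_ne h2 h3, inv_smul_eq_iff, swap_smul_ne h2 hsa]

theorem rfresh_comp_inv [Infinite 𝔸] {c : 𝔸} {d : Bool} {A : Finset 𝔸} {a : 𝔸}
    {u : 𝔸 → Bool → Raw 𝔸 X Y} {y : Y} (hca : c ≠ a)
    (h : RFresh c (comp d A a u y)) : RFresh c (fill d A a u y) := by
  obtain ⟨S, hS, hx⟩ := h
  refine ⟨insert a S, by simp [hS, hca], fun π hπ => ?_⟩
  have h1 := hx π (fun s hs => hπ s (by simp [hs]))
  have ha : π • a = a := hπ a (by simp)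
  change Eqv (comp d (π • A) (π • a) (fun b i => π • u (π⁻¹ • b) i) (π • y)) _ at h1
  obtain ⟨-, S', hS'⟩ := eqv_comp_iff.1 h1
  obtain ⟨e, he⟩ := exists_not_mem S'
  have := hS' e he
  change Eqv (swap e (π • a) • π • fill d A a u y) _ at this
  rwa [ha, Eqv.smul_iff] at this

end Action

section Subst

set_option linter.unusedSectionVars false

variable {𝔸 : Type u} [DecidableEq 𝔸] {X Y : SubSet 𝔸}

/-- Substitution `t (b := i)` on trees. A bound name is fresh for the represented element, hence
substituting for it does nothing. -/
def sub : Raw 𝔸 X Y → 𝔸 → Bool → Raw 𝔸 X Y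
  | pt x, b, i => pt (X.sub x b i)
  | fill d A a u y, b, i =>
      if b ∈ A then
        if b = a ∧ i = d then comp d A a u y else u b i
      else fill d A a (fun b' i' => sub (u b' i') b i) (Y.sub y b i)
  | comp d A a u y, b, i =>
      if b = a then comp d A a u y
      else if b ∈ A then sub (u b i) a d
      else comp d A a (fun b' i' => sub (u b' i') b i) (Y.sub y b i)

/-- The projection to `Y`. -/
def rho (f : X ⟶ Y) : Raw 𝔸 X Y → Y
  | pt x => f x
  | fill _ _ _ _ y => y
  | comp d _ a _ y => Y.sub y a d

/-- All the boxes in a tree are open boxes over `rho f`. -/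
def WF (f : X ⟶ Y) : Raw 𝔸 X Y → Prop
  | pt _ => True
  | fill d A a u y | comp d A a u y =>
      a ∈ A ∧ ∀ b i, InBox A a d b i →
        WF f (u b i) ∧ RFresh b (u b i) ∧ rho f (u b i) = Y.sub y b i ∧
          ∀ b' i', InBox A a d b' i' → b ≠ b' → Eqv (sub (u b i) b' i') (sub (u b' i') b i)

theorem wf_comp (f : X ⟶ Y) {d : Bool} {A : Finset 𝔸} {a : 𝔸} {u : 𝔸 → Bool → Raw 𝔸 X Y} {y : Y} :
    WF f (comp d A a u y) ↔ WF f (fill d A a u y) := by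
  simp only [WF]

theorem smul_sub (π : FinPerm 𝔸) (t : Raw 𝔸 X Y) (b : 𝔸) (i : Bool) :
    π • sub t b i = sub (π • t) (π • b) i := by
  induction t generalizing b i with
  | pt x => simp only [sub, smul_pt, X.smul_sub]
  | fill d A a u y ih =>
    rw [smul_fill]
    simp only [sub, Finset.smul_mem_smul_finset_iff, smul_left_cancel_iff]
    split_ifs
    · rfl
    · rw [inv_smul_smul]
    · simp only [smul_fill, ih, Y.smul_sub]
  | comp d A a u y ih =>
    rw [smul_comp]
    simp only [sub, Finset.smul_mem_smul_finset_iff, smul_left_cancel_iff]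
    split_ifs
    · rfl
    · rw [inv_smul_smul, ih]
    · simp only [smul_comp, ih, Y.smul_sub]

theorem rho_smul (f : X ⟶ Y) (π : FinPerm 𝔸) (t : Raw 𝔸 X Y) :
    rho f (π • t) = π • rho f t := by
  cases t with
  | pt x => simp only [smul_pt, rho, SubSet.hom_smul]
  | fill d A a u y => rfl
  | comp d A a u y => simp only [smul_comp, rho, Y.smul_sub]

theorem supp (t : Raw 𝔸 X Y) :
    ∃ S : Finset 𝔸, ∀ π : FinPerm 𝔸, (∀ s ∈ S, π • s = s) → Eqv (π • t) t :=
  rsupp X.finite_support Y.finite_support t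

theorem exists_rfresh (t : Raw 𝔸 X Y) : ∃ S : Finset 𝔸, ∀ c, c ∉ S → RFresh c t := by
  obtain ⟨S, hS⟩ := supp t
  exact ⟨S, fun c hc => ⟨S, hc, hS⟩⟩

theorem exists_fresh (Z : SubSet 𝔸) (z : Z) : ∃ S : Finset 𝔸, ∀ c, c ∉ S → Fresh c z := by
  obtain ⟨S, hS⟩ := Z.finite_support z
  exact ⟨S, fun c hc => ⟨S, hc, hS⟩⟩

theorem rho_eqv [Infinite 𝔸] (f : X ⟶ Y) {t s : Raw 𝔸 X Y} (h : Eqv t s) :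
    rho f t = rho f s := by
  cases h with
  | pt x => rfl
  | fill h => rfl
  | @comp d A A' a a' u u' y y' S hA hy hu =>
    obtain ⟨T, hT⟩ := exists_fresh Y (Y.sub y a d)
    obtain ⟨T', hT'⟩ := exists_fresh Y (Y.sub y' a' d)
    obtain ⟨c, hc⟩ := exists_not_mem (S ∪ T ∪ T')
    simp only [Finset.mem_union, not_or] at hc
    have key : ∀ (y : Y) (a : 𝔸), Fresh c (Y.sub y a d) →
        Y.sub (swap c a • y) c d = Y.sub y a d := by
      intro y a h
      have h1 := Y.smul_sub (swap c a) y a d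
      rw [swap_smul_right] at h1
      rw [← h1]
      have h2 := rfresh_pt (Y := Y) h
      have h3 := rfresh_pt (Y := Y) (Y.fresh_sub y a d)
      have h4 := h2.swap_eqv h3
      rw [smul_pt] at h4
      generalize swap c a • Y.sub y a d = z at h4
      cases h4
      rfl
    simp only [rho]
    rw [← key y a (hT c hc.1.2), ← key y' a' (hT' c hc.2), hy c hc.1.1]

theorem WF.smul {f : X ⟶ Y} {t : Raw 𝔸 X Y} (h : WF f t) (π : FinPerm 𝔸) : WF f (π • t) := by
  have node : ∀ (d : Bool) (A : Finset 𝔸) (a : 𝔸) (u : 𝔸 → Bool → Raw 𝔸 X Y) (y : Y)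
      (_ : ∀ b i, WF f (u b i) → WF f (π • u b i)), WF f (fill d A a u y) →
      WF f (π • fill d A a u y) := by
    intro d A a u y ih h
    obtain ⟨ha, h⟩ := h
    refine ⟨(Finset.smul_mem_smul_finset_iff π).2 ha, fun b i hb => ?_⟩
    rw [InBox.smul_iff] at hb
    obtain ⟨h1, h2, h3, h4⟩ := h _ _ hb
    refine ⟨ih _ _ h1, ?_, ?_, ?_⟩
    · have := h2.smul π
      rwa [smul_inv_smul] at this
    · change rho f (π • u (π⁻¹ • b) i) = _
      rw [rho_smul, h3, Y.smul_sub, smul_inv_smul]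
    · intro b' i' hb' hne
      rw [InBox.smul_iff] at hb'
      have := (h4 _ _ hb' (by simpa using hne)).smul π
      rw [smul_sub, smul_sub, smul_inv_smul, smul_inv_smul] at this
      exact this
  induction t with
  | pt x => trivial
  | fill d A a u y ih => exact node d A a u y ih h
  | comp d A a u y ih =>
    rw [wf_comp] at h
    rw [smul_comp, wf_comp]
    exact node d A a u y ih h

/-- Substitution makes a name fresh, and preserves freshness of other names. -/
theorem rfresh_sub [Infinite 𝔸] {f : X ⟶ Y} {t : Raw 𝔸 X Y} (h : WF f t) {b : 𝔸} {i : Bool} {c : 𝔸}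
    (hc : c = b ∨ RFresh c t) : RFresh c (sub t b i) := by
  induction t generalizing b i c with
  | pt x =>
    apply rfresh_pt
    rcases hc with rfl | hc
    · exact X.fresh_sub _ _ _
    · exact SubSet.Fresh.sub (rfresh_pt_iff.1 hc) _ _
  | fill d A a u y ih =>
    simp only [sub]
    split_ifs with h1 h2
    · obtain ⟨rfl, rfl⟩ := h2
      rcases hc with rfl | hc
      · exact rfresh_comp_self (supp _)
      · exact rfresh_comp hc
    · rcases hc with rfl | hc
      · exact (h.2 _ _ ⟨h1, h2⟩).2.1
      · exact (rfresh_fill_inv hc).2.2 _ _ ⟨h1, h2⟩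
    · apply rfresh_fill h.1
      · rcases hc with rfl | hc
        · exact h1
        · exact (rfresh_fill_inv hc).1
      · rcases hc with rfl | hc
        · exact Y.fresh_sub _ _ _
        · exact SubSet.Fresh.sub (rfresh_fill_inv hc).2.1 _ _
      · intro b' i' hb'
        refine ih b' i' (h.2 _ _ hb').1 ?_
        rcases hc with rfl | hc
        · exact Or.inl rfl
        · exact Or.inr ((rfresh_fill_inv hc).2.2 _ _ hb')
  | comp d A a u y ih =>
    rw [wf_comp] at h
    simp only [sub]
    split_ifs with h1 h2
    · subst h1
      rcases hc with rfl | hc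
      · exact rfresh_comp_self (supp _)
      · exact hc
    · refine ih b i (h.2 b i ⟨h2, fun e => h1 e.1⟩).1 ?_
      rcases hc with rfl | hc
      · exact Or.inr (h.2 _ i ⟨h2, fun e => h1 e.1⟩).2.1
      · by_cases hca : c = a
        · exact Or.inl hca
        · exact Or.inr ((rfresh_fill_inv (rfresh_comp_inv hca hc)).2.2 _ _
            ⟨h2, fun e => h1 e.1⟩)
    · by_cases hca : c = a
      · subst hca
        exact rfresh_comp_self (supp _)
      apply rfresh_comp
      have hc : c = b ∨ RFresh c (fill d A a u y) := hc.imp_right (rfresh_comp_inv hca)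
      apply rfresh_fill h.1
      · rcases hc with rfl | hc
        · exact h2
        · exact (rfresh_fill_inv hc).1
      · rcases hc with rfl | hc
        · exact Y.fresh_sub _ _ _
        · exact SubSet.Fresh.sub (rfresh_fill_inv hc).2.1 _ _
      · intro b' i' hb'
        refine ih b' i' (h.2 _ _ hb').1 ?_
        rcases hc with rfl | hc
        · exact Or.inl rfl
        · exact Or.inr ((rfresh_fill_inv hc).2.2 _ _ hb')

theorem sub_of_rfresh [Infinite 𝔸] {t : Raw 𝔸 X Y} {b : 𝔸} {i : Bool} (h : RFresh b t) :
    Eqv (sub t b i) t := by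
  induction t generalizing b i with
  | pt x =>
    rw [sub, X.sub_of_fresh _ _ _ (rfresh_pt_iff.1 h)]
    exact Eqv.refl _
  | fill d A a u y ih =>
    obtain ⟨h1, h2, h3⟩ := rfresh_fill_inv h
    simp only [sub]
    rw [if_neg h1, Y.sub_of_fresh _ _ _ h2]
    exact Eqv.fill (fun b' i' hb' => ih _ _ (h3 _ _ hb'))
  | comp d A a u y ih =>
    simp only [sub]
    by_cases hba : b = a
    · rw [if_pos hba]
      exact Eqv.refl _
    obtain ⟨h1, h2, h3⟩ := rfresh_fill_inv (rfresh_comp_inv hba h)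
    rw [if_neg hba, if_neg h1, Y.sub_of_fresh _ _ _ h2]
    exact Eqv.comp_of_fill (Eqv.fill (fun b' i' hb' => ih _ _ (h3 _ _ hb')))

theorem sub_swap_comp [Infinite 𝔸] {f : X ⟶ Y} {d : Bool} {A : Finset 𝔸} {a : 𝔸}
    {u : 𝔸 → Bool → Raw 𝔸 X Y} {y : Y} (h : WF f (comp d A a u y)) {c : 𝔸}
    (hc : RFresh c (comp d A a u y)) {b : 𝔸} (hcb : c ≠ b) (i : Bool) :
    Eqv (sub (comp d A a u y) b i) (sub (swap c a • comp d A a u y) b i) := by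
  have ha : RFresh a (comp d A a u y) := rfresh_comp_self (supp _)
  by_cases hba : b = a
  · subst hba
    have h1 : sub (comp d A b u y) b i = comp d A b u y := by simp [sub]
    rw [h1]
    have h2 := hc.smul (swap c b)
    rw [swap_smul_left] at h2
    exact (hc.swap_eqv ha).symm.trans (sub_of_rfresh h2).symm
  · have h1 := smul_sub (swap c a) (comp d A a u y) b i
    rw [swap_smul_ne (Ne.symm hcb) hba] at h1
    rw [← h1]
    exact ((rfresh_sub h (Or.inr hc)).swap_eqv (rfresh_sub h (Or.inr ha))).symm

theorem Eqv.sub [Infinite 𝔸] {f : X ⟶ Y} {t s : Raw 𝔸 X Y} (ht : WF f t) (hs : WF f s)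
    (h : Eqv t s) (b : 𝔸) (i : Bool) : Eqv (Raw.sub t b i) (Raw.sub s b i) := by
  induction t generalizing s b i with
  | pt x =>
    cases h
    exact Eqv.refl _
  | fill d A a u y ih =>
    cases h with
    | @fill _ _ _ _ u' _ h =>
    simp only [Raw.sub]
    split_ifs with h1 h2
    · exact (Eqv.fill h).comp_of_fill
    · exact h _ _ ⟨h1, h2⟩
    · exact Eqv.fill (fun b' i' hb' => ih _ _ (ht.2 _ _ hb').1 (hs.2 _ _ hb').1 (h _ _ hb') _ _)
  | comp d A a u y ih =>
    cases h with
    | @comp _ _ A' _ a' _ u' _ y' S hA hy hu =>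
    obtain ⟨T, hT⟩ := exists_rfresh (Raw.comp d A a u y)
    obtain ⟨T', hT'⟩ := exists_rfresh (Raw.comp d A' a' u' y')
    obtain ⟨c, hc⟩ := exists_not_mem (S ∪ T ∪ T' ∪ {b})
    simp only [Finset.mem_union, Finset.mem_singleton, not_or] at hc
    obtain ⟨⟨⟨h1, h2⟩, h3⟩, h4⟩ := hc
    refine (sub_swap_comp ht (hT c h2) h4 i).trans
      (Eqv.trans ?_ (sub_swap_comp hs (hT' c h3) h4 i).symm)
    have wt := (wf_comp f).1 (ht.smul (swap c a))
    have ws := (wf_comp f).1 (hs.smul (swap c a'))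
    rw [smul_comp, smul_comp, swap_smul_right, swap_smul_right]
    rw [swap_smul_right] at wt ws
    have hu := hu c h1
    have hA := hA c h1
    have hy := hy c h1
    rw [← hA, ← hy] at ws ⊢
    have key : ∀ b' i', InBox (swap c a • A) c d b' i' → ∀ b i,
        Eqv (Raw.sub (swap c a • u ((swap c a)⁻¹ • b') i') b i)
          (Raw.sub (swap c a' • u' ((swap c a')⁻¹ • b') i') b i) := by
      intro b' i' hb' b i
      have e1 := (wt.2 _ _ hb').1
      have e2 := (ws.2 _ _ hb').1
      have e3 := hu _ _ hb'
      have e4 := ih ((swap c a)⁻¹ • b') i'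
        (s := (swap c a)⁻¹ • swap c a' • u' ((swap c a')⁻¹ • b') i')
        (by
          have e0 := WF.smul e1 (swap c a)⁻¹
          change WF f ((swap c a)⁻¹ • swap c a • _) at e0
          rwa [inv_smul_smul] at e0)
        (WF.smul e2 (swap c a)⁻¹)
        ((Eqv.smul_iff (swap c a)).1 (by rwa [smul_inv_smul])) ((swap c a)⁻¹ • b) i
      have e5 := e4.smul (swap c a)
      rwa [smul_sub, smul_sub, smul_inv_smul, smul_inv_smul] at e5
    simp only [Raw.sub, if_neg (Ne.symm h4)]
    split_ifs with h5
    · exact key _ _ ⟨h5, fun e => h4 e.1.symm⟩ _ _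
    · exact Eqv.comp_of_fill (Eqv.fill (fun b' i' hb' => key _ _ hb' _ _))

theorem rho_sub {f : X ⟶ Y} {t : Raw 𝔸 X Y} (h : WF f t) (b : 𝔸) (i : Bool) :
    rho f (sub t b i) = Y.sub (rho f t) b i := by
  induction t generalizing b i with
  | pt x => simp only [sub, rho, SubSet.hom_sub]
  | fill d A a u y ih =>
    simp only [sub]
    split_ifs with h1 h2
    · obtain ⟨rfl, rfl⟩ := h2
      rfl
    · exact (h.2 _ _ ⟨h1, h2⟩).2.2.1
    · rfl
  | comp d A a u y ih =>
    rw [wf_comp] at h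
    simp only [sub]
    split_ifs with h1 h2
    · subst h1
      simp only [rho, Y.sub_sub_self]
    · obtain ⟨e1, -, e2, -⟩ := h.2 b i ⟨h2, fun e => h1 e.1⟩
      rw [ih _ _ e1, e2]
      exact Y.sub_comm _ _ _ _ _ h1
    · exact Y.sub_comm _ _ _ _ _ h1

theorem wf_sub_and_comm [Infinite 𝔸] {f : X ⟶ Y} {t : Raw 𝔸 X Y} (h : WF f t) :
    (∀ b i, WF f (sub t b i)) ∧
    ∀ b i b' i', b ≠ b' → Eqv (sub (sub t b i) b' i') (sub (sub t b' i') b i) := by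
  have node : ∀ (d : Bool) (A : Finset 𝔸) (a : 𝔸) (u : 𝔸 → Bool → Raw 𝔸 X Y) (y : Y)
      (_ : ∀ b i, WF f (u b i) → (∀ c j, WF f (sub (u b i) c j)) ∧
        ∀ c j c' j', c ≠ c' →
          Eqv (sub (sub (u b i) c j) c' j') (sub (sub (u b i) c' j') c j))
      (_ : WF f (fill d A a u y)) (b : 𝔸) (_ : b ∉ A) (i : Bool),
      WF f (fill d A a (fun b' i' => sub (u b' i') b i) (Y.sub y b i)) := by
    intro d A a u y ih h b hb i
    refine ⟨h.1, fun c j hc => ?_⟩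
    have hbc : b ≠ c := fun e => hb (e ▸ hc.1)
    obtain ⟨e1, e2, e3, e4⟩ := h.2 c j hc
    refine ⟨(ih c j e1).1 b i, rfresh_sub e1 (Or.inr e2), ?_, ?_⟩
    · rw [rho_sub e1, e3]
      exact Y.sub_comm _ _ _ _ _ (Ne.symm hbc)
    · intro c' j' hc' hne
      have hbc' : b ≠ c' := fun e => hb (e ▸ hc'.1)
      have e1' := (h.2 c' j' hc').1
      refine ((ih c j e1).2 b i c' j' hbc').trans (Eqv.trans ?_ ((ih c' j' e1').2 c j b i hbc.symm))
      exact (e4 c' j' hc' hne).sub ((ih c j e1).1 _ _) ((ih c' j' e1').1 _ _) b i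
  induction t with
  | pt x =>
    refine ⟨fun _ _ => trivial, fun b i b' i' hne => ?_⟩
    simp only [sub]
    rw [X.sub_comm _ _ _ _ _ hne]
    exact Eqv.refl _
  | fill d A a u y ih =>
    refine ⟨fun b i => ?_, ?_⟩
    · simp only [sub]
      split_ifs with h1 h2
      · exact (wf_comp f).2 h
      · exact (h.2 b i ⟨h1, h2⟩).1
      · exact node d A a u y ih h b h1 i
    · have key : ∀ b i b' i', b ≠ b' → b' ∉ A →
          Eqv (sub (sub (fill d A a u y) b i) b' i') (sub (sub (fill d A a u y) b' i') b i) := by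
        intro b i b' i' hne hb'
        have hab : b' ≠ a := fun e => hb' (e ▸ h.1)
        rw [show sub (fill d A a u y) b' i' = fill d A a (fun c j => sub (u c j) b' i')
          (Y.sub y b' i') by simp only [sub, if_neg hb']]
        simp only [sub]
        split_ifs with h1 h2
        · simp only [sub, if_neg hab, if_neg hb']
          exact Eqv.refl _
        · exact Eqv.refl _
        · simp only [sub, if_neg hb']
          rw [Y.sub_comm _ _ _ _ _ hne]
          exact Eqv.fill (fun c j hc => (ih c j (h.2 c j hc).1).2 _ _ _ _ hne)
      intro b i b' i' hne
      by_cases hb' : b' ∈ A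
      swap
      · exact key b i b' i' hne hb'
      by_cases hb : b ∈ A
      swap
      · exact (key b' i' b i hne.symm hb).symm
      simp only [sub, if_pos hb', if_pos hb]
      by_cases h1 : b = a ∧ i = d
      · obtain ⟨rfl, rfl⟩ := h1
        rw [if_pos ⟨rfl, rfl⟩, if_neg (fun e => hne e.1.symm)]
        simp only [sub, if_neg hne.symm, if_pos hb']
        exact Eqv.refl _
      · rw [if_neg h1]
        by_cases h2 : b' = a ∧ i' = d
        · obtain ⟨rfl, rfl⟩ := h2
          rw [if_pos ⟨rfl, rfl⟩]
          simp only [sub, if_neg hne, if_pos hb]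
          exact Eqv.refl _
        · rw [if_neg h2]
          exact (h.2 b i ⟨hb, h1⟩).2.2.2 b' i' ⟨hb', h2⟩ hne
  | comp d A a u y ih =>
    have hw := h
    rw [wf_comp] at h
    refine ⟨fun b i => ?_, ?_⟩
    · simp only [sub]
      split_ifs with h1 h2
      · exact hw
      · exact (ih b i (h.2 b i ⟨h2, fun e => h1 e.1⟩).1).1 _ _
      · exact (wf_comp f).2 (node d A a u y ih h b h2 i)
    · have bound : ∀ i b' i', 
          Eqv (sub (sub (comp d A a u y) a i) b' i') (sub (sub (comp d A a u y) b' i') a i) := by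
        intro i b' i'
        rw [show sub (comp d A a u y) a i = comp d A a u y by simp [sub]]
        exact (sub_of_rfresh (rfresh_sub hw (Or.inr (rfresh_comp_self (supp _))))).symm
      have key : ∀ b i b' i', b ≠ a → b' ≠ a → b ≠ b' → b' ∉ A →
          Eqv (sub (sub (comp d A a u y) b i) b' i') (sub (sub (comp d A a u y) b' i') b i) := by
        intro b i b' i' hba hba' hne hb'
        rw [show sub (comp d A a u y) b' i' = comp d A a (fun c j => sub (u c j) b' i')
          (Y.sub y b' i') by simp only [sub, if_neg hb', if_neg hba']]
        simp only [sub, if_neg hba]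
        split_ifs with h1
        · exact (ih b i (h.2 b i ⟨h1, fun e => hba e.1⟩).1).2 _ _ _ _ hba'.symm
        · simp only [sub, if_neg hb', if_neg hba']
          rw [Y.sub_comm _ _ _ _ _ hne]
          exact Eqv.comp_of_fill
            (Eqv.fill (fun c j hc => (ih c j (h.2 c j hc).1).2 _ _ _ _ hne))
      intro b i b' i' hne
      by_cases hba : b = a
      · subst hba; exact bound _ _ _
      by_cases hba' : b' = a
      · subst hba'; exact (bound _ _ _).symm
      by_cases hb' : b' ∈ A
      swap
      · exact key b i b' i' hba hba' hne hb'
      by_cases hb : b ∈ A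
      swap
      · exact (key b' i' b i hba' hba hne.symm hb).symm
      simp only [sub, if_pos hb', if_pos hb, if_neg hba, if_neg hba']
      have hi : InBox A a d b i := ⟨hb, fun e => hba e.1⟩
      have hi' : InBox A a d b' i' := ⟨hb', fun e => hba' e.1⟩
      have w1 := (h.2 b i hi).1
      have w2 := (h.2 b' i' hi').1
      refine ((ih b i w1).2 _ _ _ _ (Ne.symm hba')).trans
        (Eqv.trans ?_ ((ih b' i' w2).2 _ _ _ _ hba))
      exact ((h.2 b i hi).2.2.2 b' i' hi' hne).sub ((ih b i w1).1 _ _) ((ih b' i' w2).1 _ _) _ _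

theorem WF.sub [Infinite 𝔸] {f : X ⟶ Y} {t : Raw 𝔸 X Y} (h : WF f t) (b : 𝔸) (i : Bool) :
    WF f (Raw.sub t b i) := (wf_sub_and_comm h).1 b i

theorem sub_comm [Infinite 𝔸] {f : X ⟶ Y} {t : Raw 𝔸 X Y} (h : WF f t) {b b' : 𝔸} (hne : b ≠ b')
    (i i' : Bool) : Eqv (sub (sub t b i) b' i') (sub (sub t b' i') b i) :=
  (wf_sub_and_comm h).2 b i b' i' hne

end Subst

end Raw

section K

set_option linter.unusedSectionVars false

variable {𝔸 : Type u} [DecidableEq 𝔸] [Infinite 𝔸]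

/-! ### `K f` as a 01-substitution set, and the factorisation of `f` through it -/

/-- Representatives of elements of `K f`, up to equality of the represented elements. -/
def kSetoid {X Y : SubSet 𝔸} (f : X ⟶ Y) : Setoid {t : Raw 𝔸 X Y // t.WF f} where
  r t s := Raw.Eqv t.1 s.1
  iseqv := ⟨fun t => Raw.Eqv.refl t.1, fun h => h.symm, fun h h' => h.trans h'⟩

instance kMulAction {X Y : SubSet 𝔸} (f : X ⟶ Y) :
    MulAction (FinPerm 𝔸) (Quotient (kSetoid f)) where
  smul π := Quotient.map (fun t => ⟨π • t.1, t.2.smul π⟩) (fun _ _ h => Raw.Eqv.smul h π)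
  one_smul z := by
    induction z using Quotient.inductionOn with
    | h t => exact congrArg _ (Subtype.ext (one_smul _ t.1))
  mul_smul π σ z := by
    induction z using Quotient.inductionOn with
    | h t => exact congrArg _ (Subtype.ext (mul_smul π σ t.1))

theorem k_fresh_of {X Y : SubSet 𝔸} {f : X ⟶ Y} {b : 𝔸} {t : {t : Raw 𝔸 X Y // t.WF f}}
    (h : Raw.RFresh b t.1) : Fresh b (Quotient.mk (kSetoid f) t) := by
  obtain ⟨S, hS, hx⟩ := h
  exact ⟨S, hS, fun π hπ => Quotient.sound (hx π fun s hs => hπ (by exact_mod_cast hs))⟩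

theorem k_fresh {X Y : SubSet 𝔸} {f : X ⟶ Y} {b : 𝔸} {t : {t : Raw 𝔸 X Y // t.WF f}}
    (h : Fresh b (Quotient.mk (kSetoid f) t)) : Raw.RFresh b t.1 := by
  obtain ⟨S, hS, hx⟩ := h
  exact ⟨S, hS, fun π hπ =>
    Quotient.exact (s := kSetoid f) (hx π fun s hs => hπ s (by exact_mod_cast hs))⟩

/-- The 01-substitution set `K f`. -/
def K {X Y : SubSet 𝔸} (f : X ⟶ Y) : SubSet 𝔸 where
  carrier := Quotient (kSetoid f)
  sub z b i := Quotient.map (fun t => ⟨t.1.sub b i, t.2.sub b i⟩)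
    (fun t s h => show Raw.Eqv _ _ from Raw.Eqv.sub t.2 s.2 h b i) z
  finite_support z := by
    induction z using Quotient.inductionOn with
    | h t =>
      obtain ⟨S, hS⟩ := Raw.supp t.1
      exact ⟨S, fun π hπ => Quotient.sound (hS π fun s hs => hπ (by exact_mod_cast hs))⟩
  smul_sub π z b i := by
    induction z using Quotient.inductionOn with
    | h t => exact congrArg _ (Subtype.ext (Raw.smul_sub π t.1 b i))
  fresh_sub z b i := by
    induction z using Quotient.inductionOn with
    | h t => exact k_fresh_of (t := ⟨t.1.sub b i, t.2.sub b i⟩) (Raw.rfresh_sub t.2 (Or.inl rfl))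
  sub_of_fresh z b i h := by
    induction z using Quotient.inductionOn with
    | h t => exact Quotient.sound (Raw.sub_of_rfresh (k_fresh h))
  sub_comm z b b' i i' hne := by
    induction z using Quotient.inductionOn with
    | h t => exact Quotient.sound (Raw.sub_comm t.2 hne i i')

/-- The element of `K f` represented by a tree. -/
def K.mk {X Y : SubSet 𝔸} (f : X ⟶ Y) (t : Raw 𝔸 X Y) (h : t.WF f) : K f :=
  Quotient.mk (kSetoid f) ⟨t, h⟩

theorem K.ind {X Y : SubSet 𝔸} {f : X ⟶ Y} {p : K f → Prop} (h : ∀ t ht, p (K.mk f t ht))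
    (z : K f) : p z :=
  Quotient.inductionOn z (fun t => h t.1 t.2)

theorem K.mk_eq {X Y : SubSet 𝔸} {f : X ⟶ Y} {t s : Raw 𝔸 X Y} {ht : t.WF f} {hs : s.WF f} :
    K.mk f t ht = K.mk f s hs ↔ Raw.Eqv t s :=
  ⟨fun h => Quotient.exact (s := kSetoid f) h, fun h => Quotient.sound h⟩

theorem K.smul_mk {X Y : SubSet 𝔸} {f : X ⟶ Y} {t : Raw 𝔸 X Y} {ht : t.WF f} (π : FinPerm 𝔸) :
    π • K.mk f t ht = K.mk f (π • t) (ht.smul π) := rfl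

theorem K.sub_mk {X Y : SubSet 𝔸} {f : X ⟶ Y} {t : Raw 𝔸 X Y} {ht : t.WF f} (b : 𝔸) (i : Bool) :
    (K f).sub (K.mk f t ht) b i = K.mk f (t.sub b i) (ht.sub b i) := rfl

/-- The inclusion `X ⟶ K f`. -/
def lam {X Y : SubSet 𝔸} (f : X ⟶ Y) : X ⟶ K f :=
  SubSet.Hom.mk (fun x => K.mk f (Raw.pt x) trivial) (fun _ _ => rfl) (fun _ _ _ => rfl)

/-- The map `K f ⟶ Y`. -/
def rho {X Y : SubSet 𝔸} (f : X ⟶ Y) : K f ⟶ Y :=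
  SubSet.Hom.mk (fun z => Quotient.lift (fun t : {t : Raw 𝔸 X Y // t.WF f} => t.1.rho f)
      (fun _ _ h => Raw.rho_eqv f h) z)
    (fun π z => by
      induction z using K.ind with
      | h t ht => exact Raw.rho_smul f π t)
    (fun z b i => by
      induction z using K.ind with
      | h t ht => exact Raw.rho_sub ht b i)

theorem rho_mk {X Y : SubSet 𝔸} {f : X ⟶ Y} {t : Raw 𝔸 X Y} {ht : t.WF f} :
    rho f (K.mk f t ht) = t.rho f := rfl

theorem lam_rho {X Y : SubSet 𝔸} (f : X ⟶ Y) : lam f ≫ rho f = f := rfl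

/-! ### Open boxes over `rho f` as elements of `K f` -/

theorem K.exists_rep {X Y : SubSet 𝔸} {f : X ⟶ Y} (z : K f) :
    ∃ t : Raw 𝔸 X Y, ∃ h : t.WF f, z = K.mk f t h := by
  induction z using K.ind with
  | h t ht => exact ⟨t, ht, rfl⟩

/-- A chosen tree representing an element of `K f`. -/
noncomputable def K.rep {X Y : SubSet 𝔸} {f : X ⟶ Y} (z : K f) : Raw 𝔸 X Y :=
  (K.exists_rep z).choose

theorem K.rep_wf {X Y : SubSet 𝔸} {f : X ⟶ Y} (z : K f) : (K.rep z).WF f :=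
  (K.exists_rep z).choose_spec.choose

theorem K.mk_rep {X Y : SubSet 𝔸} {f : X ⟶ Y} (z : K f) : K.mk f (K.rep z) (K.rep_wf z) = z :=
  (K.exists_rep z).choose_spec.choose_spec.symm

/-- The values of an open box in `K f`, as trees; the values outside of
`(A × 2) \ {(a, d)}` are irrelevant. -/
noncomputable def OpenBox.rep {X Y : SubSet 𝔸} {f : X ⟶ Y} {d : Bool} {A : Finset 𝔸} {a : 𝔸}
    (B : OpenBox (rho f) d A a) (b : 𝔸) (i : Bool) : Raw 𝔸 X Y :=
  if h : InBox A a d b i then K.rep (B.u b i h) else K.rep (B.u a (!d) (inBox_base B.mem d))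

theorem OpenBox.rep_of {X Y : SubSet 𝔸} {f : X ⟶ Y} {d : Bool} {A : Finset 𝔸} {a : 𝔸}
    (B : OpenBox (rho f) d A a) {b : 𝔸} {i : Bool} (h : InBox A a d b i) :
    B.rep b i = K.rep (B.u b i h) := dif_pos h

theorem OpenBox.wf_rep {X Y : SubSet 𝔸} {f : X ⟶ Y} {d : Bool} {A : Finset 𝔸} {a : 𝔸}
    (B : OpenBox (rho f) d A a) : (Raw.fill d A a B.rep B.y).WF f := by
  refine ⟨B.mem, fun b i h => ?_⟩
  rw [B.rep_of h]
  refine ⟨K.rep_wf _, ?_, ?_, ?_⟩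
  · have h1 := B.fresh b i h
    rw [← K.mk_rep (B.u b i h)] at h1
    exact k_fresh h1
  · rw [← B.lies b i h]
    conv_rhs => rw [← K.mk_rep (B.u b i h)]
    rfl
  · intro b' i' h' hne
    rw [B.rep_of h']
    have h1 := B.adj b i h b' i' h' hne
    rw [← K.mk_rep (B.u b i h), ← K.mk_rep (B.u b' i' h')] at h1
    exact K.mk_eq.1 h1

/-- An open box `(u, y)` over `rho f`, as an element of `K f`. -/
noncomputable def K.fill {X Y : SubSet 𝔸} {f : X ⟶ Y} {d : Bool} {A : Finset 𝔸} {a : 𝔸}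
    (B : OpenBox (rho f) d A a) : K f :=
  K.mk f (Raw.fill d A a B.rep B.y) B.wf_rep

theorem K.mk_eq_fill {X Y : SubSet 𝔸} {f : X ⟶ Y} {d : Bool} {A : Finset 𝔸} {a : 𝔸}
    (B : OpenBox (rho f) d A a) {u : 𝔸 → Bool → Raw 𝔸 X Y} (h : (Raw.fill d A a u B.y).WF f)
    (hu : ∀ b i (hb : InBox A a d b i), K.mk f (u b i) (h.2 b i hb).1 = B.u b i hb) :
    K.mk f (Raw.fill d A a u B.y) h = K.fill B := by
  refine K.mk_eq.2 (Raw.Eqv.fill fun b i hb => ?_)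
  rw [B.rep_of hb]
  have h1 := hu b i hb
  rw [← K.mk_rep (B.u b i hb)] at h1
  exact K.mk_eq.1 h1

theorem K.rho_fill {X Y : SubSet 𝔸} {f : X ⟶ Y} {d : Bool} {A : Finset 𝔸} {a : 𝔸}
    (B : OpenBox (rho f) d A a) : rho f (K.fill B) = B.y := rfl

theorem K.smul_fill {X Y : SubSet 𝔸} {f : X ⟶ Y} {d : Bool} {A : Finset 𝔸} {a : 𝔸}
    (B : OpenBox (rho f) d A a) (π : FinPerm 𝔸) : π • K.fill B = K.fill (B.smul π) := by
  refine K.mk_eq_fill (B.smul π) (B.wf_rep.smul π) (fun b i hb => ?_)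
  have hb' := (InBox.smul_iff π).1 hb
  change _ = π • B.u (π⁻¹ • b) i hb'
  rw [← K.mk_rep (B.u (π⁻¹ • b) i hb'), K.smul_mk, K.mk_eq]
  change Raw.Eqv (π • B.rep (π⁻¹ • b) i) _
  rw [B.rep_of hb']
  exact Raw.Eqv.refl _

theorem K.sub_fill_of_mem {X Y : SubSet 𝔸} {f : X ⟶ Y} {d : Bool} {A : Finset 𝔸} {a : 𝔸}
    (B : OpenBox (rho f) d A a) {b : 𝔸} {i : Bool} (h : InBox A a d b i) :
    (K f).sub (K.fill B) b i = B.u b i h := by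
  rw [← K.mk_rep (B.u b i h), K.fill, K.sub_mk, K.mk_eq]
  simp only [Raw.sub, if_pos h.1, if_neg h.2, B.rep_of h]
  exact Raw.Eqv.refl _

theorem K.sub_fill_of_not_mem {X Y : SubSet 𝔸} {f : X ⟶ Y} {d : Bool} {A : Finset 𝔸} {a : 𝔸}
    (B : OpenBox (rho f) d A a) {c : 𝔸} (j : Bool) (h : c ∉ A) :
    (K f).sub (K.fill B) c j = K.fill (B.sub c j h) := by
  have e : (Raw.fill d A a B.rep B.y).sub c j =
      Raw.fill d A a (fun b i => (B.rep b i).sub c j) (Y.sub B.y c j) := by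
    simp only [Raw.sub, if_neg h]
  have w := B.wf_rep.sub c j
  have e2 : (K f).sub (K.fill B) c j = K.mk f _ (e ▸ w) := by
    rw [K.fill, K.sub_mk, K.mk_eq, e]
    exact Raw.Eqv.refl _
  rw [e2]
  refine K.mk_eq_fill (B.sub c j h) _ (fun b i hb => ?_)
  change _ = (K f).sub (B.u b i hb) c j
  rw [← K.mk_rep (B.u b i hb), K.sub_mk, K.mk_eq, B.rep_of hb]
  exact Raw.Eqv.refl _

/-! ### Functoriality of `K` -/

/-- The action of a commutative square `(h, k)` on trees. -/
def Raw.map {U V X Y : SubSet 𝔸} (h : U ⟶ X) (k : V ⟶ Y) : Raw 𝔸 U V → Raw 𝔸 X Y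
  | pt x => pt (h x)
  | fill d A a u y => fill d A a (fun b i => (u b i).map h k) (k y)
  | comp d A a u y => comp d A a (fun b i => (u b i).map h k) (k y)

section Map

variable {U V X Y : SubSet 𝔸} {g : U ⟶ V} {f : X ⟶ Y} {h : U ⟶ X} {k : V ⟶ Y}

theorem Raw.map_smul (h : U ⟶ X) (k : V ⟶ Y) (π : FinPerm 𝔸) (t : Raw 𝔸 U V) :
    (π • t).map h k = π • t.map h k := by
  induction t with
  | pt x => simp only [smul_pt, Raw.map, SubSet.hom_smul]
  | fill d A a u y ih => simp only [Raw.smul_fill, Raw.map, SubSet.hom_smul, ih]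
  | comp d A a u y ih => simp only [smul_comp, Raw.map, SubSet.hom_smul, ih]

theorem Raw.map_sub (h : U ⟶ X) (k : V ⟶ Y) (t : Raw 𝔸 U V) (b : 𝔸) (i : Bool) :
    (t.sub b i).map h k = (t.map h k).sub b i := by
  induction t generalizing b i with
  | pt x => simp only [Raw.sub, Raw.map, SubSet.hom_sub]
  | fill d A a u y ih =>
    simp only [Raw.sub, Raw.map]
    split_ifs
    · rfl
    · rfl
    · simp only [Raw.map, ih, SubSet.hom_sub]
  | comp d A a u y ih =>
    simp only [Raw.sub, Raw.map]
    split_ifs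
    · rfl
    · exact ih _ _ _ _
    · simp only [Raw.map, ih, SubSet.hom_sub]

theorem Raw.rho_map (sq : CommSq h g f k) (t : Raw 𝔸 U V) :
    (t.map h k).rho f = k (t.rho g) := by
  cases t with
  | pt x => exact SubSet.congr_hom sq.w x
  | fill d A a u y => rfl
  | comp d A a u y => simp only [Raw.map, Raw.rho, SubSet.hom_sub]

theorem Raw.Eqv.map (h : U ⟶ X) (k : V ⟶ Y) {t s : Raw 𝔸 U V} (e : Raw.Eqv t s) :
    Raw.Eqv (t.map h k) (s.map h k) := by
  induction e with
  | pt x => exact Raw.Eqv.refl _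
  | fill _ ih => exact Raw.Eqv.fill ih
  | comp S hA hy hu ih =>
    refine Raw.Eqv.comp S hA ?_ ?_
    · intro c hc
      rw [← SubSet.hom_smul, ← SubSet.hom_smul, hy c hc]
    · intro c hc b i hb
      rw [← Raw.map_smul, ← Raw.map_smul]
      exact ih c hc b i hb

theorem Raw.RFresh.map (h : U ⟶ X) (k : V ⟶ Y) {b : 𝔸} {t : Raw 𝔸 U V} (e : Raw.RFresh b t) :
    Raw.RFresh b (t.map h k) := by
  obtain ⟨S, hS, hx⟩ := e
  refine ⟨S, hS, fun π hπ => ?_⟩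
  rw [← Raw.map_smul]
  exact (hx π hπ).map h k

theorem Raw.WF.map (sq : CommSq h g f k) {t : Raw 𝔸 U V} (e : t.WF g) : (t.map h k).WF f := by
  have node : ∀ (d : Bool) (A : Finset 𝔸) (a : 𝔸) (u : 𝔸 → Bool → Raw 𝔸 U V) (y : V)
      (_ : ∀ b i, (u b i).WF g → ((u b i).map h k).WF f),
      (Raw.fill d A a u y).WF g → ((Raw.fill d A a u y).map h k).WF f := by
    intro d A a u y ih e
    refine ⟨e.1, fun b i hb => ?_⟩
    obtain ⟨e1, e2, e3, e4⟩ := e.2 b i hb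
    refine ⟨ih b i e1, e2.map h k, ?_, ?_⟩
    · rw [Raw.rho_map sq, e3, SubSet.hom_sub]
    · intro b' i' hb' hne
      rw [← Raw.map_sub, ← Raw.map_sub]
      exact (e4 b' i' hb' hne).map h k
  induction t with
  | pt x => trivial
  | fill d A a u y ih => exact node d A a u y ih e
  | comp d A a u y ih =>
    exact (Raw.wf_comp f).2 (node d A a u y ih ((Raw.wf_comp g).1 e))

/-- The morphism `K(h, k) : K g ⟶ K f` given by a commutative square
`(h, k) : g ⟶ f`. -/
def K.map (sq : CommSq h g f k) : K g ⟶ K f :=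
  SubSet.Hom.mk
    (fun z => Quotient.map (sa := kSetoid g) (sb := kSetoid f)
      (fun t => ⟨t.1.map h k, t.2.map sq⟩) (fun _ _ e => Raw.Eqv.map h k e) z)
    (fun π z => by
      induction z using K.ind with
      | h t ht => exact K.mk_eq.2 (by rw [Raw.map_smul]; exact Raw.Eqv.refl _))
    (fun z b i => by
      induction z using K.ind with
      | h t ht => exact K.mk_eq.2 (by rw [Raw.map_sub]; exact Raw.Eqv.refl _))

end Map

/-! ### The diagonal `Δ : X ⟶ X ×_Y X` -/

/-- The fibre product `X ×_Y X` of `f : X ⟶ Y` with itself. -/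
def fiberSq {X Y : SubSet 𝔸} (f : X ⟶ Y) : SubSet 𝔸 where
  carrier := {p : X × X // f p.1 = f p.2}
  act :=
    { smul := fun π p => ⟨(π • p.1.1, π • p.1.2), by
        rw [SubSet.hom_smul, SubSet.hom_smul, p.2]⟩
      one_smul := fun p => Subtype.ext (Prod.ext (one_smul _ p.1.1) (one_smul _ p.1.2))
      mul_smul := fun π σ p =>
        Subtype.ext (Prod.ext (mul_smul π σ p.1.1) (mul_smul π σ p.1.2)) }
  sub p a i := ⟨(X.sub p.1.1 a i, X.sub p.1.2 a i), by
    rw [SubSet.hom_sub, SubSet.hom_sub, p.2]⟩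
  finite_support p := by
    obtain ⟨S, hS⟩ := X.finite_support p.1.1
    obtain ⟨T, hT⟩ := X.finite_support p.1.2
    refine ⟨S ∪ T, fun π hπ => Subtype.ext (Prod.ext (hS π ?_) (hT π ?_))⟩
    · exact fun s hs => hπ (by simpa using Or.inl hs)
    · exact fun s hs => hπ (by simpa using Or.inr hs)
  smul_sub π p a i :=
    Subtype.ext (Prod.ext (X.smul_sub π p.1.1 a i) (X.smul_sub π p.1.2 a i))
  fresh_sub p a i := by
    obtain ⟨S, hS, hS'⟩ := X.fresh_sub p.1.1 a i
    obtain ⟨T, hT, hT'⟩ := X.fresh_sub p.1.2 a i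
    refine ⟨S ∪ T, by simp [hS, hT], fun π hπ => Subtype.ext (Prod.ext (hS' π ?_) (hT' π ?_))⟩
    · exact fun s hs => hπ (by simpa using Or.inl hs)
    · exact fun s hs => hπ (by simpa using Or.inr hs)
  sub_of_fresh p a i h := by
    obtain ⟨S, hS, hx⟩ := h
    refine Subtype.ext (Prod.ext (X.sub_of_fresh _ _ _ ?_) (X.sub_of_fresh _ _ _ ?_))
    · exact ⟨S, hS, fun π hπ => congrArg (fun q => q.1.1) (hx π hπ)⟩
    · exact ⟨S, hS, fun π hπ => congrArg (fun q => q.1.2) (hx π hπ)⟩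
  sub_comm p a b i j hne :=
    Subtype.ext (Prod.ext (X.sub_comm _ _ _ _ _ hne) (X.sub_comm _ _ _ _ _ hne))

/-- The canonical map `X ×_Y X ⟶ Y`. -/
def fiberSq.toBase {X Y : SubSet 𝔸} (f : X ⟶ Y) : fiberSq f ⟶ Y :=
  SubSet.Hom.mk (fun p => f p.1.1) (fun π p => SubSet.hom_smul f π p.1.1)
    (fun p a i => SubSet.hom_sub f p.1.1 a i)

/-- The diagonal `Δ : X ⟶ X ×_Y X`. -/
def diag {X Y : SubSet 𝔸} (f : X ⟶ Y) : X ⟶ fiberSq f :=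
  SubSet.Hom.mk (fun x => ⟨(x, x), rfl⟩) (fun _ _ => rfl) (fun _ _ _ => rfl)

/-- The map `U ×_V U ⟶ X ×_Y X` given by a commutative square. -/
def fiberSq.map {U V X Y : SubSet 𝔸} {g : U ⟶ V} {f : X ⟶ Y} {h : U ⟶ X} {k : V ⟶ Y}
    (sq : CommSq h g f k) : fiberSq g ⟶ fiberSq f :=
  SubSet.Hom.mk
    (fun p => ⟨(h p.1.1, h p.1.2), by
      have e := SubSet.congr_hom sq.w
      simp only [SubSet.comp_apply] at e
      rw [e, e, p.2]⟩)
    (fun π p => Subtype.ext (Prod.ext (SubSet.hom_smul h π p.1.1) (SubSet.hom_smul h π p.1.2)))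
    (fun p a i => Subtype.ext
      (Prod.ext (SubSet.hom_sub h p.1.1 a i) (SubSet.hom_sub h p.1.2 a i)))

theorem diag_commSq {U V X Y : SubSet 𝔸} {g : U ⟶ V} {f : X ⟶ Y} {h : U ⟶ X} {k : V ⟶ Y}
    (sq : CommSq h g f k) : CommSq h (diag g) (diag f) (fiberSq.map sq) := ⟨rfl⟩

/-! ### Normal forms and the labelled path object -/

/-- The pre-normal forms in direction `a`, as elements of `K Δ`. -/
inductive PreNormal {X Y : SubSet 𝔸} (f : X ⟶ Y) (a : 𝔸) : K (diag f) → Prop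
  | pt (x : X) (h : Fresh a x) : PreNormal f a (lam (diag f) x)
  | fill {A : Finset 𝔸} (B : OpenBox (rho (diag f)) true A a) (hx : Fresh a B.y.1.1)
      (h0 : B.u a false (inBox_base B.mem true) = lam (diag f) B.y.1.1)
      (hu : ∀ b i (hb : InBox A a true b i), b ≠ a → PreNormal f a (B.u b i hb)) :
      PreNormal f a (K.fill B)

/-- The normal forms in `K Δ`: the elements `z (a := 1)` for `z` a pre-normal form in some
direction `a`. -/
def IsNormal {X Y : SubSet 𝔸} (f : X ⟶ Y) (w : K (diag f)) : Prop :=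
  ∃ (a : 𝔸) (z : K (diag f)), PreNormal f a z ∧ w = (K (diag f)).sub z a true

theorem PreNormal.smul {X Y : SubSet 𝔸} {f : X ⟶ Y} {a : 𝔸} {z : K (diag f)}
    (h : PreNormal f a z) (π : FinPerm 𝔸) : PreNormal f (π • a) (π • z) := by
  induction h with
  | pt x h =>
    rw [← SubSet.hom_smul]
    exact PreNormal.pt _ (h.smul π)
  | @fill A B hx h0 hu ih =>
    rw [K.smul_fill]
    refine PreNormal.fill (B.smul π) (hx.smul π) ?_ ?_
    · change π • B.u (π⁻¹ • π • a) false _ = lam (diag f) (π • B.y.1.1)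
      rw [SubSet.hom_smul, ← h0]
      congr 2
      exact inv_smul_smul π a
    · intro b i hb hne
      exact ih _ i ((InBox.smul_iff π).1 hb) (fun e => hne (by rw [← e, smul_inv_smul]))

theorem PreNormal.sub {X Y : SubSet 𝔸} {f : X ⟶ Y} {a : 𝔸} {z : K (diag f)}
    (h : PreNormal f a z) {c : 𝔸} (hc : c ≠ a) (j : Bool) :
    PreNormal f a ((K (diag f)).sub z c j) := by
  induction h with
  | pt x h =>
    rw [← SubSet.hom_sub]
    exact PreNormal.pt _ (SubSet.Fresh.sub h c j)
  | @fill A B hx h0 hu ih =>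
    by_cases hA : c ∈ A
    · have hb : InBox A a true c j := ⟨hA, fun e => hc e.1⟩
      rw [K.sub_fill_of_mem B hb]
      exact hu c j hb hc
    · rw [K.sub_fill_of_not_mem B j hA]
      refine PreNormal.fill (B.sub c j hA) (SubSet.Fresh.sub hx c j) ?_ ?_
      · change (K (diag f)).sub (B.u a false _) c j = lam (diag f) (X.sub B.y.1.1 c j)
        rw [SubSet.hom_sub, h0]
      · exact fun b i hb hne => ih b i hb hne

theorem IsNormal.smul {X Y : SubSet 𝔸} {f : X ⟶ Y} {w : K (diag f)} (h : IsNormal f w)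
    (π : FinPerm 𝔸) : IsNormal f (π • w) := by
  obtain ⟨a, z, hz, rfl⟩ := h
  exact ⟨π • a, π • z, hz.smul π, SubSet.smul_sub _ _ _ _ _⟩

theorem IsNormal.sub {X Y : SubSet 𝔸} {f : X ⟶ Y} {w : K (diag f)} (h : IsNormal f w)
    (c : 𝔸) (j : Bool) : IsNormal f ((K (diag f)).sub w c j) := by
  obtain ⟨a, z, hz, rfl⟩ := h
  by_cases hc : c = a
  · subst hc
    exact ⟨c, z, hz, SubSet.sub_sub_self _ _ _ _ _⟩
  · exact ⟨a, _, hz.sub hc j, SubSet.sub_comm _ _ _ _ _ _ (Ne.symm hc)⟩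

/-- The labelled path object `P_Y X`: the 01-substitution set of normal forms in `K Δ`. -/
def P {X Y : SubSet 𝔸} (f : X ⟶ Y) : SubSet 𝔸 where
  carrier := {w : K (diag f) // IsNormal f w}
  act :=
    { smul := fun π w => ⟨π • w.1, w.2.smul π⟩
      one_smul := fun w => Subtype.ext (one_smul _ w.1)
      mul_smul := fun π σ w => Subtype.ext (mul_smul π σ w.1) }
  sub w c j := ⟨(K (diag f)).sub w.1 c j, w.2.sub c j⟩
  finite_support w := by
    obtain ⟨S, hS⟩ := (K (diag f)).finite_support w.1
    exact ⟨S, fun π hπ => Subtype.ext (hS π hπ)⟩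
  smul_sub π w c j := Subtype.ext ((K (diag f)).smul_sub π w.1 c j)
  fresh_sub w c j := by
    obtain ⟨S, hS, hx⟩ := (K (diag f)).fresh_sub w.1 c j
    exact ⟨S, hS, fun π hπ => Subtype.ext (hx π hπ)⟩
  sub_of_fresh w c j h := by
    obtain ⟨S, hS, hx⟩ := h
    exact Subtype.ext ((K (diag f)).sub_of_fresh w.1 c j
      ⟨S, hS, fun π hπ => congrArg Subtype.val (hx π hπ)⟩)
  sub_comm w a b i j hne := Subtype.ext ((K (diag f)).sub_comm w.1 a b i j hne)

/-- The inclusion of `P_Y X` in `K Δ`. -/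
def P.incl {X Y : SubSet 𝔸} (f : X ⟶ Y) : P f ⟶ K (diag f) :=
  SubSet.Hom.mk (fun w => w.1) (fun _ _ => rfl) (fun _ _ _ => rfl)

/-- The map `p_f : P_Y X ⟶ Y`, the composite of `ρ_Δ` with the canonical map
`X ×_Y X ⟶ Y`. -/
def P.proj {X Y : SubSet 𝔸} (f : X ⟶ Y) : P f ⟶ Y :=
  P.incl f ≫ rho (diag f) ≫ fiberSq.toBase f

end K

end ZeroOne

/-! Restriction to normal forms and functoriality follow by induction on trees; the pullback
statement carries the content. Pullbacks of 01-substitution sets can be tested on elements, so it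
suffices that a normal form over `g` is determined by its image over `f` together with its base
point in `V`, and that every compatible pair arises in this way.

For arbitrary elements of `K Δ` this argument breaks down at `⟨a⟩(u, y)`: only `y(a := 1)` is
visible in the base, and this does not determine a lift of `y` itself. In a pre-normal form `a` is
fresh for the first endpoint, hence for the base point, so passing to `a := 1` loses nothing in the
base (`PreNormal.toBase_sub`). Nothing is lost in the box either: a pre-normal form in a given
direction is recovered from its normal form (`PreNormal.eq_of_sub_true_eq`), because abstraction of
one fixed name is injective. Finally, every name fresh for a normal form can serve as its direction
(`IsNormal.exists_of_fresh`). The question is thereby moved from normal forms to pre-normal forms in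
one common direction.

For these, uniqueness (`PreNormal.ext_of_isPullback`) is an induction. The endpoints are determined
since `U ×_V U` is the pullback of `X ×_Y X` along `k`; the faces are determined inductively, except
for the face at `(a, 0)`, which is the first endpoint. Existence (`PreNormal.exists_of_isPullback`)
lifts the endpoints and all faces. Adjacency of the lifted faces, and also freshness, in the form
`x(b := 0) = x`, are equations between pre-normal forms that hold over `f` and in `V`, so uniqueness
supplies them. -/

namespace ZeroOne

/-! ### Transpositions of fresh names -/

section Nominal

variable {𝔸 : Type u} [DecidableEq 𝔸] [Infinite 𝔸]

/-- This is `Raw.RFresh.swap_eqv` for the leaf `pt x`, since `Eqv` between leaves is equality. The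
second type parameter of the tree plays no role and is set to `X`. -/
theorem Fresh.swap_smul {X : Type u} [MulAction (FinPerm 𝔸) X] {a b : 𝔸} {x : X}
    (ha : Fresh a x) (hb : Fresh b x) : swap a b • x = x := by
  have h := (Raw.rfresh_pt (Y := X) ha).swap_eqv (Raw.rfresh_pt hb)
  rw [Raw.smul_pt] at h
  generalize swap a b • x = z at h ⊢
  cases h
  rfl

theorem SubSet.exists_fresh₂ {X Y : SubSet 𝔸} (x : X) (y : Y) :
    ∃ c : 𝔸, Fresh c x ∧ Fresh c y := by
  obtain ⟨S, hS⟩ := X.finite_support x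
  obtain ⟨T, hT⟩ := Y.finite_support y
  obtain ⟨c, hc⟩ := Raw.exists_not_mem (S ∪ T)
  simp only [Finset.mem_union, not_or] at hc
  exact ⟨c, ⟨S, hc.1, hS⟩, ⟨T, hc.2, hT⟩⟩

end Nominal

/-! ### Pullbacks of 01-substitution sets in terms of elements -/

section Pullback

variable {𝔸 : Type u} [DecidableEq 𝔸]

/-- A name is fresh for every element that substitution for it leaves unchanged. -/
theorem SubSet.fresh_of_sub_eq {X : SubSet 𝔸} {x : X} {a : 𝔸} {i : Bool}
    (h : X.sub x a i = x) : Fresh a x :=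
  h ▸ X.fresh_sub x a i

/-- The fibre product of two morphisms of 01-substitution sets. -/
def fiberProd {X V Y : SubSet 𝔸} (f : X ⟶ Y) (k : V ⟶ Y) : SubSet 𝔸 where
  carrier := {p : X × V // f p.1 = k p.2}
  act :=
    { smul := fun π p => ⟨(π • p.1.1, π • p.1.2), by
        rw [SubSet.hom_smul, SubSet.hom_smul, p.2]⟩
      one_smul := fun p => Subtype.ext (Prod.ext (one_smul _ p.1.1) (one_smul _ p.1.2))
      mul_smul := fun π σ p =>
        Subtype.ext (Prod.ext (mul_smul π σ p.1.1) (mul_smul π σ p.1.2)) }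
  sub p a i := ⟨(X.sub p.1.1 a i, V.sub p.1.2 a i), by
    rw [SubSet.hom_sub, SubSet.hom_sub, p.2]⟩
  finite_support p := by
    obtain ⟨S, hS⟩ := X.finite_support p.1.1
    obtain ⟨T, hT⟩ := V.finite_support p.1.2
    refine ⟨S ∪ T, fun π hπ => Subtype.ext (Prod.ext (hS π ?_) (hT π ?_))⟩
    · exact fun s hs => hπ (by simpa using Or.inl hs)
    · exact fun s hs => hπ (by simpa using Or.inr hs)
  smul_sub π p a i :=
    Subtype.ext (Prod.ext (X.smul_sub π p.1.1 a i) (V.smul_sub π p.1.2 a i))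
  fresh_sub p a i := by
    obtain ⟨S, hS, hS'⟩ := X.fresh_sub p.1.1 a i
    obtain ⟨T, hT, hT'⟩ := V.fresh_sub p.1.2 a i
    refine ⟨S ∪ T, by simp [hS, hT], fun π hπ => Subtype.ext (Prod.ext (hS' π ?_) (hT' π ?_))⟩
    · exact fun s hs => hπ (by simpa using Or.inl hs)
    · exact fun s hs => hπ (by simpa using Or.inr hs)
  sub_of_fresh p a i h := by
    obtain ⟨S, hS, hx⟩ := h
    refine Subtype.ext (Prod.ext (X.sub_of_fresh _ _ _ ?_) (V.sub_of_fresh _ _ _ ?_))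
    · exact ⟨S, hS, fun π hπ => congrArg (fun q => q.1.1) (hx π hπ)⟩
    · exact ⟨S, hS, fun π hπ => congrArg (fun q => q.1.2) (hx π hπ)⟩
  sub_comm p a b i j hne :=
    Subtype.ext (Prod.ext (X.sub_comm _ _ _ _ _ hne) (V.sub_comm _ _ _ _ _ hne))

/-- The first projection of a fibre product. -/
def fiberProd.fst {X V Y : SubSet 𝔸} (f : X ⟶ Y) (k : V ⟶ Y) : fiberProd f k ⟶ X :=
  SubSet.Hom.mk (fun p => p.1.1) (fun _ _ => rfl) (fun _ _ _ => rfl)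

/-- The second projection of a fibre product. -/
def fiberProd.snd {X V Y : SubSet 𝔸} (f : X ⟶ Y) (k : V ⟶ Y) : fiberProd f k ⟶ V :=
  SubSet.Hom.mk (fun p => p.1.2) (fun _ _ => rfl) (fun _ _ _ => rfl)

/-- The comparison map to the fibre product given by a commutative square. -/
def fiberProd.ofCommSq {U V X Y : SubSet 𝔸} {g : U ⟶ V} {f : X ⟶ Y} {h : U ⟶ X} {k : V ⟶ Y}
    (sq : CommSq h g f k) : U ⟶ fiberProd f k :=
  SubSet.Hom.mk (fun z => ⟨(h z, g z), SubSet.congr_hom sq.w z⟩)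
    (fun π z => Subtype.ext (Prod.ext (SubSet.hom_smul h π z) (SubSet.hom_smul g π z)))
    (fun z a i => Subtype.ext (Prod.ext (SubSet.hom_sub h z a i) (SubSet.hom_sub g z a i)))

variable {U V X Y : SubSet 𝔸} {g : U ⟶ V} {f : X ⟶ Y} {h : U ⟶ X} {k : V ⟶ Y}

/-- The universal property, applied to the concrete fibre product, gives a left inverse of the
comparison map from `U`, which is therefore injective. -/
theorem isPullback_ext (pb : IsPullback h g f k) {z z' : U} (e₁ : h z = h z') (e₂ : g z = g z') :
    z = z' := by
  let l := pb.lift (fiberProd.fst f k) (fiberProd.snd f k) (SubSet.hom_ext fun p => p.2)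
  have hl : fiberProd.ofCommSq pb.toCommSq ≫ l = 𝟙 U := by
    apply pb.hom_ext
    · rw [Category.assoc, pb.lift_fst, Category.id_comp]; rfl
    · rw [Category.assoc, pb.lift_snd, Category.id_comp]; rfl
  have hz : fiberProd.ofCommSq pb.toCommSq z = fiberProd.ofCommSq pb.toCommSq z' :=
    Subtype.ext (Prod.ext e₁ e₂)
  have e := congrArg (fun p => l p) hz
  have e₃ := SubSet.congr_hom hl z
  have e₄ := SubSet.congr_hom hl z'
  exact e₃.symm.trans (e.trans e₄)

theorem isPullback_exists (pb : IsPullback h g f k) {x : X} {v : V} (e : f x = k v) :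
    ∃ z : U, h z = x ∧ g z = v := by
  have w : fiberProd.fst f k ≫ f = fiberProd.snd f k ≫ k := SubSet.hom_ext fun p => p.2
  exact ⟨pb.lift _ _ w ⟨(x, v), e⟩, SubSet.congr_hom (pb.lift_fst _ _ w) _,
    SubSet.congr_hom (pb.lift_snd _ _ w) _⟩

/-- A lift chosen pointwise is automatically a morphism: equivariance and compatibility with
substitution are equations in `U`, and joint injectivity reduces them to equations in `X` and `V`.
-/
theorem isPullback_of_existsUnique (sq : CommSq h g f k)
    (ext : ∀ z z' : U, h z = h z' → g z = g z' → z = z')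
    (ex : ∀ (x : X) (v : V), f x = k v → ∃ z : U, h z = x ∧ g z = v) :
    IsPullback h g f k := by
  choose l hl₁ hl₂ using ex
  have w : ∀ (s : Limits.PullbackCone f k) (x : s.pt), f (s.fst x) = k (s.snd x) :=
    fun s x => SubSet.congr_hom s.condition x
  refine ⟨sq, ⟨Limits.PullbackCone.IsLimit.mk sq.w
    (fun s => SubSet.Hom.mk (fun x => l (s.fst x) (s.snd x) (w s x)) ?_ ?_) ?_ ?_ ?_⟩⟩
  · intro π x
    apply ext
    · rw [hl₁, SubSet.hom_smul, SubSet.hom_smul, hl₁]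
    · rw [hl₂, SubSet.hom_smul, SubSet.hom_smul, hl₂]
  · intro x a i
    apply ext
    · rw [hl₁, SubSet.hom_sub, SubSet.hom_sub, hl₁]
    · rw [hl₂, SubSet.hom_sub, SubSet.hom_sub, hl₂]
  · exact fun s => SubSet.hom_ext fun x => hl₁ _ _ _
  · exact fun s => SubSet.hom_ext fun x => hl₂ _ _ _
  · intro s m h₁ h₂
    refine SubSet.hom_ext fun x => ext _ _ ?_ ?_
    · exact (SubSet.congr_hom h₁ x).trans (hl₁ _ _ _).symm
    · exact (SubSet.congr_hom h₂ x).trans (hl₂ _ _ _).symm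

/-- Both coordinates of a point of `U ×_V U` lie over the same point of `V`, so the pullback
property applies to each coordinate. With the next lemma, `U ×_V U` is the pullback of `X ×_Y X`
along `k`. -/
theorem fiberSq.ext_of_isPullback (pb : IsPullback h g f k) {p q : fiberSq g}
    (e₁ : fiberSq.map pb.toCommSq p = fiberSq.map pb.toCommSq q)
    (e₂ : fiberSq.toBase g p = fiberSq.toBase g q) : p = q := by
  have a₁ : h p.1.1 = h q.1.1 := congrArg (fun r : fiberSq f => r.1.1) e₁
  have a₂ : h p.1.2 = h q.1.2 := congrArg (fun r : fiberSq f => r.1.2) e₁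
  have b₁ : g p.1.1 = g q.1.1 := e₂
  have b₂ : g p.1.2 = g q.1.2 := by rw [← p.2, ← q.2, b₁]
  exact Subtype.ext (Prod.ext (isPullback_ext pb a₁ b₁) (isPullback_ext pb a₂ b₂))

theorem fiberSq.exists_of_isPullback (pb : IsPullback h g f k) {p : fiberSq f} {v : V}
    (e : fiberSq.toBase f p = k v) :
    ∃ q : fiberSq g, fiberSq.map pb.toCommSq q = p ∧ fiberSq.toBase g q = v := by
  obtain ⟨z₁, h₁, g₁⟩ := isPullback_exists pb (x := p.1.1) (v := v) e
  obtain ⟨z₂, h₂, g₂⟩ := isPullback_exists pb (x := p.1.2) (v := v) (p.2.symm.trans e)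
  exact ⟨⟨(z₁, z₂), g₁.trans g₂.symm⟩, Subtype.ext (Prod.ext h₁ h₂), g₁⟩

end Pullback

/-! ### Identities and composites of maps on trees -/

section KMap

variable {𝔸 : Type u} [DecidableEq 𝔸]

theorem Raw.map_id {X Y : SubSet 𝔸} (t : Raw 𝔸 X Y) : t.map (𝟙 X) (𝟙 Y) = t := by
  induction t with
  | pt x => rfl
  | fill d A a u y ih => simp only [Raw.map, ih, SubSet.id_apply]
  | comp d A a u y ih => simp only [Raw.map, ih, SubSet.id_apply]

theorem Raw.map_comp {U V X Y Z W : SubSet 𝔸} (h : U ⟶ X) (k : V ⟶ Y) (h' : X ⟶ Z) (k' : Y ⟶ W)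
    (t : Raw 𝔸 U V) : t.map (h ≫ h') (k ≫ k') = (t.map h k).map h' k' := by
  induction t with
  | pt x => rfl
  | fill d A a u y ih => simp only [Raw.map, ih, SubSet.comp_apply]
  | comp d A a u y ih => simp only [Raw.map, ih, SubSet.comp_apply]

variable [Infinite 𝔸]

/-! ### Recovering an open box from the element it represents -/

section Fill

variable {X Y : SubSet 𝔸} {f : X ⟶ Y} {d : Bool} {a : 𝔸}

/-- Kept apart from `K.fill_injective` because boxes with different index sets have different types
and can be compared only after `A = A'` has been substituted. -/
theorem K.fill_injective_index {A A' : Finset 𝔸} {B : OpenBox (rho f) d A a}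
    {B' : OpenBox (rho f) d A' a} (e : K.fill B = K.fill B') : A = A' :=
  (Raw.eqv_fill_iff.1 (K.mk_eq.1 e)).2.1

/-- The element remembers the box: its faces are the substitution instances at `(b, i)`, and its `y`
is the image under `rho`. -/
theorem K.fill_injective {A : Finset 𝔸} {B B' : OpenBox (rho f) d A a}
    (e : K.fill B = K.fill B') : B = B' := by
  refine OpenBox.ext ?_ ?_
  · funext b i hb
    rw [← K.sub_fill_of_mem B hb, e, K.sub_fill_of_mem]
  · rw [← K.rho_fill B, e, K.rho_fill]

theorem K.fill_ne_lam {A : Finset 𝔸} (B : OpenBox (rho f) d A a) (x : X) :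
    K.fill B ≠ lam f x := by
  intro e
  cases K.mk_eq.1 e

theorem K.sub_fill_self {A : Finset 𝔸} (B : OpenBox (rho f) d A a) :
    (K f).sub (K.fill B) a d =
      K.mk f (Raw.comp d A a B.rep B.y) ((Raw.wf_comp f).2 B.wf_rep) := by
  refine K.mk_eq.2 ?_
  simp only [Raw.sub, if_pos B.mem, and_self, if_true]
  exact Raw.Eqv.refl _

theorem K.sub_fill_self_ne_lam {A : Finset 𝔸} (B : OpenBox (rho f) d A a) (x : X) :
    (K f).sub (K.fill B) a d ≠ lam f x := by
  rw [K.sub_fill_self]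
  intro e
  cases K.mk_eq.1 e

/-- Both sides bind the same name `a`. Hence `α`-equivalence gives an equality of the boxes after
one and the same transposition `(c a)`, which can be cancelled. -/
theorem K.sub_fill_self_injective {A A' : Finset 𝔸} {B : OpenBox (rho f) d A a}
    {B' : OpenBox (rho f) d A' a}
    (e : (K f).sub (K.fill B) a d = (K f).sub (K.fill B') a d) : K.fill B = K.fill B' := by
  rw [K.sub_fill_self, K.sub_fill_self] at e
  obtain ⟨-, S, hS⟩ := Raw.eqv_comp_iff.1 (K.mk_eq.1 e)
  obtain ⟨c, hc⟩ := Raw.exists_not_mem S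
  exact K.mk_eq.2 ((Raw.Eqv.smul_iff _).1 (hS c hc))

end Fill

section

variable {U V X Y : SubSet 𝔸} {g : U ⟶ V} {f : X ⟶ Y} {h : U ⟶ X} {k : V ⟶ Y}

theorem K.rho_map (sq : CommSq h g f k) (z : K g) : rho f (K.map sq z) = k (rho g z) := by
  induction z using K.ind with
  | h t ht => exact Raw.rho_map sq t

/-- The image under `K(h, k)` of an open box over `rho g`. -/
def OpenBox.map (sq : CommSq h g f k) {d : Bool} {A : Finset 𝔸} {a : 𝔸}
    (B : OpenBox (rho g) d A a) : OpenBox (rho f) d A a where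
  mem := B.mem
  u b i hb := K.map sq (B.u b i hb)
  y := k B.y
  fresh b i hb := SubSet.Fresh.map _ (B.fresh b i hb)
  adj b i hb b' i' hb' hne := by
    rw [← SubSet.hom_sub, ← SubSet.hom_sub, B.adj b i hb b' i' hb' hne]
  lies b i hb := by rw [K.rho_map, B.lies, SubSet.hom_sub]

theorem K.map_fill (sq : CommSq h g f k) {d : Bool} {A : Finset 𝔸} {a : 𝔸}
    (B : OpenBox (rho g) d A a) : K.map sq (K.fill B) = K.fill (B.map sq) := by
  -- The mapped representatives of the faces need not be the chosen representatives of the mapped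
  -- faces; it is enough that they define the same elements.
  refine K.mk_eq_fill (B.map sq) (B.wf_rep.map sq) fun b i hb => ?_
  change _ = K.map sq (B.u b i hb)
  rw [← K.mk_rep (B.u b i hb)]
  refine K.mk_eq.2 ?_
  rw [B.rep_of hb]
  exact Raw.Eqv.refl _

end

end KMap

/-! ### Pre-normal forms as paths, and the choice of their direction -/

section NormalForms

variable {𝔸 : Type u} [DecidableEq 𝔸] [Infinite 𝔸]

section

variable {X Y : SubSet 𝔸} {f : X ⟶ Y} {a : 𝔸} {z z' : K (diag f)}

theorem PreNormal.fresh_fst (hz : PreNormal f a z) : Fresh a (rho (diag f) z).1.1 := by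
  cases hz with
  | pt x hx => exact hx
  | fill B hx h0 hu => exact hx

theorem PreNormal.sub_false (hz : PreNormal f a z) :
    (K (diag f)).sub z a false = lam (diag f) (rho (diag f) z).1.1 := by
  cases hz with
  | pt x hx => exact (K (diag f)).sub_of_fresh _ _ _ (SubSet.Fresh.map _ hx)
  | fill B hx h0 hu => exact (K.sub_fill_of_mem B (inBox_base B.mem true)).trans h0

/-- Only `a := 1` may leave the pre-normal forms. The excluded pair is the one missing from a
`1`-open box, so every substitution occurring in the box axioms is allowed. -/
theorem PreNormal.sub_of_ne (hz : PreNormal f a z) {c : 𝔸} {j : Bool}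
    (hc : ¬ (c = a ∧ j = true)) : PreNormal f a ((K (diag f)).sub z c j) := by
  by_cases hca : c = a
  · subst hca
    obtain rfl : j = false := by simpa using hc
    rw [hz.sub_false]
    exact PreNormal.pt _ hz.fresh_fst
  · exact hz.sub hca j

theorem PreNormal.box_value {A : Finset 𝔸} {B : OpenBox (rho (diag f)) true A a}
    (hB : PreNormal f a (K.fill B)) {b : 𝔸} {i : Bool} (hb : InBox A a true b i) :
    PreNormal f a (B.u b i hb) := by
  rw [← K.sub_fill_of_mem B hb]
  exact hB.sub_of_ne hb.2

/-- The base point is the image of the first endpoint, for which `a` is fresh: the path stays in one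
fibre of `f`. -/
theorem PreNormal.toBase_sub (hz : PreNormal f a z) (i : Bool) :
    fiberSq.toBase f (rho (diag f) ((K (diag f)).sub z a i)) =
      fiberSq.toBase f (rho (diag f) z) := by
  rw [SubSet.hom_sub, SubSet.hom_sub]
  exact Y.sub_of_fresh _ _ _ (SubSet.Fresh.map f hz.fresh_fst)

/-- Under `a := 1` a point stays a point and a box becomes an abstraction, so the two kinds cannot
be confused; on boxes, abstraction of the fixed name `a` is injective. -/
theorem PreNormal.eq_of_sub_true_eq (hz : PreNormal f a z) (hz' : PreNormal f a z')
    (e : (K (diag f)).sub z a true = (K (diag f)).sub z' a true) : z = z' := by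
  have pt_sub : ∀ x : X, Fresh a x →
      (K (diag f)).sub (lam (diag f) x) a true = lam (diag f) x :=
    fun x hx => (K (diag f)).sub_of_fresh _ _ _ (SubSet.Fresh.map _ hx)
  cases hz with
  | pt x hx =>
    cases hz' with
    | pt x' hx' => rwa [pt_sub x hx, pt_sub x' hx'] at e
    | fill B' _ _ _ =>
      rw [pt_sub x hx] at e
      exact absurd e.symm (K.sub_fill_self_ne_lam B' x)
  | fill B _ _ _ =>
    cases hz' with
    | pt x' hx' =>
      rw [pt_sub x' hx'] at e
      exact absurd e (K.sub_fill_self_ne_lam B x')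
    | fill B' _ _ _ => exact K.sub_fill_self_injective e

/-- Both `c` and the given direction `a` are fresh for `z(a := 1)`, so the transposition `(c a)`
fixes it while carrying `z` to a pre-normal form in direction `c`. -/
theorem IsNormal.exists_of_fresh {w : K (diag f)} (hw : IsNormal f w) {c : 𝔸} (hc : Fresh c w) :
    ∃ z, PreNormal f c z ∧ w = (K (diag f)).sub z c true := by
  obtain ⟨a, z, hz, rfl⟩ := hw
  refine ⟨swap c a • z, ?_, ?_⟩
  · simpa using hz.smul (swap c a)
  · have e := (K (diag f)).smul_sub (swap c a) z a true
    rwa [swap_smul_right, hc.swap_smul ((K (diag f)).fresh_sub _ _ _)] at e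

end

/-! ### Base change of pre-normal forms -/

variable {U V X Y : SubSet 𝔸} {g : U ⟶ V} {f : X ⟶ Y} {h : U ⟶ X} {k : V ⟶ Y}

theorem PreNormal.map (sq : CommSq h g f k) {a : 𝔸} {z : K (diag g)} (hz : PreNormal g a z) :
    PreNormal f a (K.map (diag_commSq sq) z) := by
  induction hz with
  | pt x hx => exact PreNormal.pt (h x) (SubSet.Fresh.map h hx)
  | @fill A B hx h0 hu ih =>
    rw [K.map_fill]
    refine PreNormal.fill _ (SubSet.Fresh.map h hx) ?_ fun b i hb hne => ih b i hb hne
    change K.map (diag_commSq sq) (B.u a false _) = _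
    rw [h0]
    rfl

theorem IsNormal.map (sq : CommSq h g f k) {w : K (diag g)} (hw : IsNormal g w) :
    IsNormal f (K.map (diag_commSq sq) w) := by
  obtain ⟨a, z, hz, rfl⟩ := hw
  exact ⟨a, _, hz.map sq, SubSet.hom_sub _ _ _ _⟩

/-- The restriction of `K(h, h × h)` to normal forms. -/
def P.map (sq : CommSq h g f k) : P g ⟶ P f :=
  SubSet.Hom.mk (fun w => ⟨K.map (diag_commSq sq) w.1, w.2.map sq⟩)
    (fun π w => Subtype.ext (SubSet.hom_smul (K.map (diag_commSq sq)) π w.1))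
    (fun w a i => Subtype.ext (SubSet.hom_sub (K.map (diag_commSq sq)) w.1 a i))

theorem K.toBase_rho_map (sq : CommSq h g f k) (z : K (diag g)) :
    fiberSq.toBase f (rho (diag f) (K.map (diag_commSq sq) z)) =
      k (fiberSq.toBase g (rho (diag g) z)) := by
  rw [K.rho_map]
  exact SubSet.congr_hom sq.w _

/-- A pre-normal form is determined by its image and its base point. -/
theorem PreNormal.ext_of_isPullback (pb : IsPullback h g f k) {a : 𝔸} {z z' : K (diag g)}
    (hz : PreNormal g a z) (hz' : PreNormal g a z')
    (e₁ : K.map (diag_commSq pb.toCommSq) z = K.map (diag_commSq pb.toCommSq) z')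
    (e₂ : fiberSq.toBase g (rho (diag g) z) = fiberSq.toBase g (rho (diag g) z')) :
    z = z' := by
  -- Equality of the endpoints is carried through the induction; for faces it follows from that of
  -- the whole boxes, as each face lies over `y(b := i)`.
  have er : rho (diag g) z = rho (diag g) z' :=
    fiberSq.ext_of_isPullback pb (by
      rw [← K.rho_map (diag_commSq pb.toCommSq), ← K.rho_map (diag_commSq pb.toCommSq), e₁]) e₂
  induction hz generalizing z' with
  | pt x hx =>
    cases hz' with
    | pt x' hx' => exact congrArg (lam (diag g)) (congrArg (fun p : fiberSq g => p.1.1) er)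
    | fill B' _ _ _ =>
      rw [K.map_fill] at e₁
      exact absurd e₁.symm (K.fill_ne_lam _ (h x))
  | @fill A B hx h0 hu ih =>
    cases hz' with
    | pt x' hx' =>
      rw [K.map_fill] at e₁
      exact absurd e₁ (K.fill_ne_lam _ (h x'))
    | @fill A' B' hx' h0' hu' =>
      rw [K.map_fill, K.map_fill] at e₁
      obtain rfl := K.fill_injective_index e₁
      have eB := K.fill_injective e₁
      have ey : B.y = B'.y := er
      refine congrArg K.fill (OpenBox.ext ?_ ey)
      funext b i hb
      have eu : K.map (diag_commSq pb.toCommSq) (B.u b i hb) =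
          K.map (diag_commSq pb.toCommSq) (B'.u b i hb) :=
        congrArg (fun C => OpenBox.u C b i hb) eB
      have erb : rho (diag g) (B.u b i hb) = rho (diag g) (B'.u b i hb) := by
        rw [B.lies, B'.lies, ey]
      -- The face at `(a, 0)`, the only one in direction `a`, is not covered by the induction
      -- hypothesis; it is the first endpoint in both boxes.
      by_cases hba : b = a
      · subst hba
        obtain rfl : i = false := by simpa using hb.2
        exact h0.trans ((congrArg (fun p : fiberSq g => lam (diag g) p.1.1) ey).trans h0'.symm)
      · exact ih b i hb hba (hu' b i hb hba) eu (by rw [erb]) erb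

/-- Pre-normal forms lift along a pullback square. -/
theorem PreNormal.exists_of_isPullback (pb : IsPullback h g f k) {a : 𝔸} {z : K (diag f)}
    (hz : PreNormal f a z) {v : V} (hv : Fresh a v)
    (e : fiberSq.toBase f (rho (diag f) z) = k v) :
    ∃ z' : K (diag g), PreNormal g a z' ∧ K.map (diag_commSq pb.toCommSq) z' = z ∧
      fiberSq.toBase g (rho (diag g) z') = v := by
  -- Freshness of `a` is the equation `s(a := 0) = s`, which can be checked in `X` and in `V`.
  have fresh_lift : ∀ {s : U} {w : V}, Fresh a (h s) → Fresh a w → g s = w → Fresh a s := by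
    intro s w hs hw es
    refine SubSet.fresh_of_sub_eq (i := false) (isPullback_ext pb ?_ ?_)
    · rw [SubSet.hom_sub, X.sub_of_fresh _ _ _ hs]
    · rw [SubSet.hom_sub, es, V.sub_of_fresh _ _ _ hw]
  induction hz generalizing v with
  | pt x hx =>
    obtain ⟨s, rfl, es⟩ := isPullback_exists pb (x := x) (v := v) e
    exact ⟨lam (diag g) s, PreNormal.pt s (fresh_lift hx hv es), rfl, es⟩
  | @fill A B hx h0 hu ih =>
    obtain ⟨q, hq₁, hq₂⟩ := fiberSq.exists_of_isPullback pb (p := B.y) (v := v) e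
    have hq : h q.1.1 = B.y.1.1 := congrArg (fun p : fiberSq f => p.1.1) hq₁
    have fq : Fresh a q.1.1 := fresh_lift (hq.symm ▸ hx) hv hq₂
    -- Faces with `b ≠ a` are lifted inductively over `v(b := i)`, for which `a` is still fresh. The
    -- face at `(a, 0)` is lifted by the first endpoint of `q`, since `v(a := 0) = v`.
    have lift : ∀ b i (hb : InBox A a true b i), ∃ z' : K (diag g), PreNormal g a z' ∧
        K.map (diag_commSq pb.toCommSq) z' = B.u b i hb ∧
        fiberSq.toBase g (rho (diag g) z') = V.sub v b i := by
      intro b i hb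
      by_cases hba : b = a
      · subst hba
        obtain rfl : i = false := by simpa using hb.2
        refine ⟨lam (diag g) q.1.1, PreNormal.pt _ fq, ?_, ?_⟩
        · rw [h0, ← hq]
          rfl
        · rw [V.sub_of_fresh _ _ _ hv]
          exact hq₂
      · refine ih b i hb hba (SubSet.Fresh.sub hv b i) ?_
        rw [B.lies, SubSet.hom_sub, SubSet.hom_sub]
        exact congrArg (fun y => Y.sub y b i) e
    choose l hl₁ hl₂ hl₃ using lift
    have sub_base : ∀ b i hb c j, fiberSq.toBase g (rho (diag g) ((K (diag g)).sub (l b i hb) c j))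
        = V.sub (V.sub v b i) c j := by
      intro b i hb c j
      rw [SubSet.hom_sub, SubSet.hom_sub, hl₃]
    let C : OpenBox (rho (diag g)) true A a :=
      { mem := B.mem
        u := l
        y := q
        fresh := fun b i hb => by
          -- The value `0` keeps the substituted face pre-normal even when `b = a`, where `a := 1`
          -- would not be covered.
          refine SubSet.fresh_of_sub_eq (i := false) (PreNormal.ext_of_isPullback pb
            ((hl₁ b i hb).sub_of_ne (by simp)) (hl₁ b i hb) ?_ ?_)
          · rw [SubSet.hom_sub, hl₂, (K (diag f)).sub_of_fresh _ _ _ (B.fresh b i hb)]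
          · rw [sub_base, hl₃, V.sub_sub_self]
        adj := fun b i hb b' i' hb' hne => by
          refine PreNormal.ext_of_isPullback pb ((hl₁ b i hb).sub_of_ne hb'.2)
            ((hl₁ b' i' hb').sub_of_ne hb.2) ?_ ?_
          · rw [SubSet.hom_sub, SubSet.hom_sub, hl₂, hl₂, B.adj b i hb b' i' hb' hne]
          · rw [sub_base, sub_base, V.sub_comm _ _ _ _ _ hne]
        lies := fun b i hb => by
          refine fiberSq.ext_of_isPullback pb ?_ ?_
          · rw [← K.rho_map (diag_commSq pb.toCommSq), hl₂, B.lies, SubSet.hom_sub, hq₁]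
          · rw [hl₃, SubSet.hom_sub, hq₂] }
    refine ⟨K.fill C, PreNormal.fill C fq ?_ fun b i hb _ => hl₁ b i hb, ?_, hq₂⟩
    · have hb := inBox_base B.mem true
      refine PreNormal.ext_of_isPullback pb (hl₁ a false hb) (PreNormal.pt _ fq) ?_ ?_
      · rw [hl₂]
        refine h0.trans ?_
        rw [← hq]
        rfl
      · rw [hl₃, V.sub_of_fresh _ _ _ hv]
        exact hq₂.symm
    · rw [K.map_fill]
      refine congrArg K.fill (OpenBox.ext ?_ hq₁)
      funext b i hb
      exact hl₂ b i hb

/-! ### The labelled path object: base change and functoriality -/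

theorem P.map_commSq (sq : CommSq h g f k) : CommSq (P.map sq) (P.proj g) (P.proj f) k :=
  ⟨SubSet.hom_ext fun w => K.toBase_rho_map sq w.1⟩

theorem P.map_ext_of_isPullback (pb : IsPullback h g f k) (w w' : P g)
    (e₁ : P.map pb.toCommSq w = P.map pb.toCommSq w') (e₂ : P.proj g w = P.proj g w') :
    w = w' := by
  -- A name fresh for both normal forms provides pre-normal forms in the same direction, which is
  -- what the injectivity of `c := 1` and the uniqueness of lifts require.
  obtain ⟨c, hc, hc'⟩ := SubSet.exists_fresh₂ w w'
  obtain ⟨z, hz, ez⟩ := w.2.exists_of_fresh (SubSet.Fresh.map (P.incl g) hc)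
  obtain ⟨z', hz', ez'⟩ := w'.2.exists_of_fresh (SubSet.Fresh.map (P.incl g) hc')
  have e₁' : K.map (diag_commSq pb.toCommSq) w.1 = K.map (diag_commSq pb.toCommSq) w'.1 :=
    congrArg Subtype.val e₁
  have e₂' : fiberSq.toBase g (rho (diag g) w.1) = fiberSq.toBase g (rho (diag g) w'.1) := e₂
  rw [ez, ez', SubSet.hom_sub, SubSet.hom_sub] at e₁'
  rw [ez, ez', hz.toBase_sub, hz'.toBase_sub] at e₂'
  have ezz := PreNormal.ext_of_isPullback pb hz hz'
    ((hz.map _).eq_of_sub_true_eq (hz'.map _) e₁') e₂'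
  exact Subtype.ext (by rw [ez, ez', ezz])

theorem P.exists_of_isPullback (pb : IsPullback h g f k) (w : P f) (v : V)
    (e : P.proj f w = k v) : ∃ w' : P g, P.map pb.toCommSq w' = w ∧ P.proj g w' = v := by
  -- The direction must also be fresh for `v`: a pre-normal form in direction `c` has a base point
  -- for which `c` is fresh.
  obtain ⟨c, hc, hv⟩ := SubSet.exists_fresh₂ w v
  obtain ⟨z, hz, ez⟩ := w.2.exists_of_fresh (SubSet.Fresh.map (P.incl f) hc)
  have e' : fiberSq.toBase f (rho (diag f) w.1) = k v := e
  rw [ez, hz.toBase_sub] at e'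
  obtain ⟨z', hz', h₁, h₂⟩ := hz.exists_of_isPullback pb hv e'
  refine ⟨⟨(K (diag g)).sub z' c true, c, z', hz', rfl⟩, Subtype.ext ?_, ?_⟩
  · change K.map (diag_commSq pb.toCommSq) _ = w.1
    rw [SubSet.hom_sub, h₁, ez]
  · exact (hz'.toBase_sub true).trans h₂

theorem P.map_isPullback (pb : IsPullback h g f k) :
    IsPullback (P.map pb.toCommSq) (P.proj g) (P.proj f) k :=
  isPullback_of_existsUnique (P.map_commSq _) (P.map_ext_of_isPullback pb)
    (P.exists_of_isPullback pb)

theorem P.map_id (sq : CommSq (𝟙 X) f f (𝟙 Y)) : P.map sq = 𝟙 (P f) := by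
  refine SubSet.hom_ext fun w => Subtype.ext ?_
  change K.map (diag_commSq sq) w.1 = w.1
  generalize w.1 = z
  induction z using K.ind with
  | h t ht =>
    refine K.mk_eq.2 ?_
    -- For the identity square, the map induced on `X ×_Y X` is the identity by definition.
    have e : t.map (𝟙 X) (fiberSq.map sq) = t := Raw.map_id t
    change Raw.Eqv (t.map (𝟙 X) (fiberSq.map sq)) t
    rw [e]
    exact Raw.Eqv.refl _

theorem P.map_comp {Z W : SubSet 𝔸} {e : Z ⟶ W} {h' : X ⟶ Z} {k' : Y ⟶ W}
    (sq : CommSq h g f k) (sq' : CommSq h' f e k') :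
    P.map (sq.horiz_comp sq') = P.map sq ≫ P.map sq' := by
  refine SubSet.hom_ext fun w => Subtype.ext ?_
  change K.map (diag_commSq (sq.horiz_comp sq')) w.1 =
    K.map (diag_commSq sq') (K.map (diag_commSq sq) w.1)
  generalize w.1 = z
  induction z using K.ind with
  | h t ht =>
    refine K.mk_eq.2 ?_
    have e := Raw.map_comp h (fiberSq.map sq) h' (fiberSq.map sq') t
    rw [← e]
    exact Raw.Eqv.refl _

end NormalForms

end ZeroOne

theorem mainTheorem6 {𝔸 : Type u} [DecidableEq 𝔸] [Infinite 𝔸] :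
    ∃ Pmap : ∀ {U V X Y : ZeroOne.SubSet 𝔸} {g : U ⟶ V} {f : X ⟶ Y} {h : U ⟶ X} {k : V ⟶ Y},
        CommSq h g f k → (ZeroOne.P g ⟶ ZeroOne.P f),
      -- the map is the restriction to normal forms of the map `K Δ_g ⟶ K Δ_f`
      (∀ {U V X Y : ZeroOne.SubSet 𝔸} {g : U ⟶ V} {f : X ⟶ Y} {h : U ⟶ X} {k : V ⟶ Y}
        (sq : CommSq h g f k),
        Pmap sq ≫ ZeroOne.P.incl f =
          ZeroOne.P.incl g ≫ ZeroOne.K.map (ZeroOne.diag_commSq sq)) ∧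
      -- functoriality
      (∀ {X Y : ZeroOne.SubSet 𝔸} (f : X ⟶ Y),
        Pmap (CommSq.mk (by simp) : CommSq (𝟙 X) f f (𝟙 Y)) = 𝟙 (ZeroOne.P f)) ∧
      (∀ {U V X Y Z W : ZeroOne.SubSet 𝔸} {g : U ⟶ V} {f : X ⟶ Y} {e : Z ⟶ W}
        {h : U ⟶ X} {k : V ⟶ Y} {h' : X ⟶ Z} {k' : Y ⟶ W}
        (sq : CommSq h g f k) (sq' : CommSq h' f e k'),
        Pmap (sq.horiz_comp sq') = Pmap sq ≫ Pmap sq') ∧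
      -- the induced square over `k` commutes
      (∀ {U V X Y : ZeroOne.SubSet 𝔸} {g : U ⟶ V} {f : X ⟶ Y} {h : U ⟶ X} {k : V ⟶ Y}
        (sq : CommSq h g f k),
        CommSq (Pmap sq) (ZeroOne.P.proj g) (ZeroOne.P.proj f) k) ∧
      -- and is a pullback if the given square is one
      (∀ {U V X Y : ZeroOne.SubSet 𝔸} {g : U ⟶ V} {f : X ⟶ Y} {h : U ⟶ X} {k : V ⟶ Y}
        (sq : CommSq h g f k), IsPullback h g f k →
        IsPullback (Pmap sq) (ZeroOne.P.proj g) (ZeroOne.P.proj f) k) := by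
  -- In the last component the square contained in `pb` and the given `sq` agree by proof
  -- irrelevance.
  refine ⟨fun sq => ZeroOne.P.map sq, fun sq => rfl, fun f => ZeroOne.P.map_id _,
    fun sq sq' => ZeroOne.P.map_comp sq sq', fun sq => ZeroOne.P.map_commSq sq,
    fun sq pb => ZeroOne.P.map_isPullback pb⟩
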